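/- Let $k\ge 0$ and let $\mathcal A=\bigoplus_{i\ge 0}\mathcal A^i$ be a rational Poincaré duality algebra of formal dimension $4k$: a graded-commutative graded $\mathbb Q$-algebra, finite-dimensional in each degree, with $\mathcal A^i=0$ for $i>4k$ and $\dim_{\mathbb Q}\mathcal A^{4k}=1$, such that the multiplication $\mathcal A^i\times\mathcal A^{4k-i}\to\mathcal A^{4k}$ is nondegenerate for all $i$. An orientation is an element $\omega\in\mathcal A^{4k}\setminus\{0\}$; it defines the symmetric inner product $\cdot_\omega$ on $\mathcal A^{2k}$ by $xy=(x\cdot_\omega y)\,\omega$. Write $(\mathcal A^{2k},\cdot_\omega)\in W(\mathbb Z)$ if the class of $(\mathcal A^{2k},\cdot_\omega)$ in the Witt group $W(\mathbb Q)$ of symmetric inner product spaces lies in the image of $W(\mathbb Z)\to W(\mathbb Q)$, and consider the integrality condition $$(\ast)\qquad (\mathcal A^{2k},\cdot_\omega)\in W(\mathbb Z)\quad\text{for some orientation }\omega .$$ Put $r=\dim_{\mathbb Q}\mathcal A^{2k}$. For an orientation $\omega$ and a basis of $\mathcal A^{2k}$ in which the matrix of $\cdot_\omega$ is diagonal, $A_\omega=\operatorname{diag}(a_1,\dots,a_r)$,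 put, for each prime $p$, $\varepsilon_p(A_\omega)=\prod_{1\le i<j\le r}(a_i,a_j)_p$, where $(a,b)_p$ is the Hilbert symbol, equal to $1$ if $z^2=ax^2+by^2$ has a nonzero solution in $\mathbb Q_p^3$ and to $-1$ otherwise. 1. Let $r$ be odd. For every orientation $\omega$ there is $\lambda\in\mathbb Q^*$ such that the discriminant of $\cdot_{\lambda\omega}$ is $1$ modulo $\mathbb Q^{*2}$. If $\omega$ is an orientation and $A_\omega=\operatorname{diag}(a_1,\dots,a_r)$ with $a_1\cdots a_r\in\mathbb Q^{*2}$, then $(\ast)$ holds if and only if $\varepsilon_p(A_\omega)=1$ for all odd primes $p$. 2. Let $r$ be even, let $\omega$ be any orientation, $A_\omega=\operatorname{diag}(a_1,\dots,a_r)$, and let $\epsilon=\operatorname{sgn}(a_1\cdots a_r)$. - If $r\equiv 0\pmod 4$ and $\epsilon=+1$, or $r\equiv 2\pmod 4$ and $\epsilon=-1$, then $(\ast)$ holds if and only if $|a_1\cdots a_r|\in\mathbb Q^{*2}$ and $\varepsilon_p(A_\omega)=1$ for all odd primes $p$. - If $r\equiv 0\pmod 4$ and $\epsilon=-1$, or $r\equiv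 2\pmod 4$ and $\epsilon=+1$, then $(\ast)$ holds if and only if $|a_1\cdots a_r|\in\mathbb Q^{*2}$ and $\varepsilon_p(A_\omega)=1$ for all primes $p\equiv 1\pmod 4$. -/

import Mathlib

open scoped TensorProduct

namespace RatPDA

universe u v w

/-! ## Rational Poincaré duality algebras -/

section Algebra

variable {A : Type v} [Ring A] [Algebra ℚ A]

/-- `A = ⨁ 𝒜 i` is a Poincaré duality algebra over `ℚ` of formal dimension `m`:
a graded-commutative graded algebra, finite-dimensional in each degree, zero above degree `m`,
with one-dimensional top degree `m`, and for which the products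
`A^i × A^(m-i) → A^m` are nondegenerate. (Nondegeneracy in the other variable follows by graded
commutativity, and `A^0 = ℚ` follows from `dim A^m = 1` and nondegeneracy.) -/
structure IsPDA (𝒜 : ℕ → Submodule ℚ A) [GradedAlgebra 𝒜] (m : ℕ) : Prop where
  graded_comm : ∀ i j : ℕ, ∀ x ∈ 𝒜 i, ∀ y ∈ 𝒜 j, x * y = (-1) ^ (i * j) * (y * x)
  finite : ∀ i, Module.Finite ℚ (𝒜 i)
  eq_bot : ∀ i, m < i → 𝒜 i = ⊥
  finrank_top : Module.finrank ℚ (𝒜 m) = 1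
  nondegenerate : ∀ i j : ℕ, i + j = m → ∀ x ∈ 𝒜 i, (∀ y ∈ 𝒜 j, x * y = 0) → x = 0

variable {𝒜 : ℕ → Submodule ℚ A} [GradedAlgebra 𝒜] {k : ℕ}

lemma mul_mem_top (x y : 𝒜 (2 * k)) : (x : A) * (y : A) ∈ 𝒜 (4 * k) := by
  have h := SetLike.mul_mem_graded x.2 y.2
  rwa [show 2 * k + 2 * k = 4 * k by ring] at h

/-- The Poincaré inner product `·_ω` on the middle component `A^(2k)`, for an orientation
`ω ∈ A^(4k) \ {0}`: it is the coefficient of the product with respect to `ω`, that is,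
`x * y = (x ·_ω y) ω` (see `poincareForm_spec`). -/
noncomputable def poincareForm (h : IsPDA 𝒜 (4 * k)) (ω : 𝒜 (4 * k)) (hω : ω ≠ 0) :
    LinearMap.BilinForm ℚ (𝒜 (2 * k)) :=
  LinearMap.mk₂ ℚ
    (fun x y => (FiniteDimensional.basisSingleton Unit h.finrank_top ω hω).coord ()
      ⟨(x : A) * (y : A), mul_mem_top x y⟩)
    (fun x x' y => by
      rw [← map_add]; congr 1; ext; simp [add_mul])
    (fun c x y => by
      rw [← map_smul]; congr 1; ext; simp)
    (fun x y y' => by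
      rw [← map_add]; congr 1; ext; simp [mul_add])
    (fun c x y => by
      rw [← map_smul]; congr 1; ext; simp)

lemma poincareForm_spec (h : IsPDA 𝒜 (4 * k)) (ω : 𝒜 (4 * k)) (hω : ω ≠ 0)
    (x y : 𝒜 (2 * k)) : (x : A) * (y : A) = poincareForm h ω hω x y • (ω : A) := by
  have h1 := (FiniteDimensional.basisSingleton Unit h.finrank_top ω hω).sum_repr
    ⟨(x : A) * (y : A), mul_mem_top x y⟩
  rw [Fintype.sum_unique, FiniteDimensional.basisSingleton_apply] at h1
  exact (congrArg Subtype.val h1).symm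

end Algebra

/-! ## Inner product modules and Witt classes -/

section Witt

variable {R : Type u} [CommRing R] {M : Type v} [AddCommGroup M] [Module R M]
  {M' : Type w} [AddCommGroup M'] [Module R M']

/-- `(M, b)` is a symmetric inner product space over `R`: `M` is finitely generated projective,
`b` is symmetric, and `b` identifies `M` with its dual. -/
structure IsInnerProductSpace (b : LinearMap.BilinForm R M) : Prop where
  finite : Module.Finite R M
  projective : Module.Projective R M
  symm : b.IsSymm
  bijective : Function.Bijective (b : M → Module.Dual R M)

/-- `(M, b)` is a split inner product space: it has a direct summand which is equal to its own
orthogonal complement. -/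
structure IsSplit (b : LinearMap.BilinForm R M) : Prop extends IsInnerProductSpace b where
  exists_summand : ∃ N N' : Submodule R M, IsCompl N N' ∧ b.orthogonal N = N

/-- The orthogonal sum `b ⟂ b'` on `M × M'`. -/
def orthogonalSum (b : LinearMap.BilinForm R M) (b' : LinearMap.BilinForm R M') :
    LinearMap.BilinForm R (M × M') :=
  b.compl₁₂ (LinearMap.fst R M M') (LinearMap.fst R M M') +
    b'.compl₁₂ (LinearMap.snd R M M') (LinearMap.snd R M M')

/-- Two symmetric inner product spaces have the same class in the Witt group `W(R)`: they become
isometric after adding split inner product spaces. (The split spaces are finitely generated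
modules, so they may be taken in the universe of `R`.) -/
def WittEquiv (b : LinearMap.BilinForm R M) (b' : LinearMap.BilinForm R M') : Prop :=
  ∃ (S S' : Type u) (_ : AddCommGroup S) (_ : Module R S) (_ : AddCommGroup S') (_ : Module R S')
    (s : LinearMap.BilinForm R S) (s' : LinearMap.BilinForm R S'),
    IsSplit s ∧ IsSplit s' ∧ (orthogonalSum b s).Equivalent (orthogonalSum b' s')

/-- `(V, b) ∈ W(ℤ)`: the class of the rational inner product space `(V, b)` in `W(ℚ)` lies in the
image of `W(ℤ) → W(ℚ)`, `[L, β] ↦ [ℚ ⊗ L, ℚ ⊗ β]`. -/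
def MemWittInt {V : Type v} [AddCommGroup V] [Module ℚ V] (b : LinearMap.BilinForm ℚ V) : Prop :=
  ∃ (L : Type) (_ : AddCommGroup L) (β : LinearMap.BilinForm ℤ L),
    IsInnerProductSpace β ∧ WittEquiv (LinearMap.BilinForm.baseChange ℚ β) b

end Witt

/-- `(A^(2k), ·_ω)` is a symmetric inner product space over `ℚ`. -/
lemma isInnerProductSpace_poincareForm {A : Type v} [Ring A] [Algebra ℚ A]
    {𝒜 : ℕ → Submodule ℚ A} [GradedAlgebra 𝒜] {k : ℕ} (h : IsPDA 𝒜 (4 * k)) (ω : 𝒜 (4 * k))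
    (hω : ω ≠ 0) : IsInnerProductSpace (poincareForm h ω hω) where
  finite := h.finite _
  projective := inferInstance
  symm := by
    constructor
    intro x y
    have hω' : (ω : A) ≠ 0 := fun h0 => hω (Subtype.ext h0)
    apply smul_left_injective ℚ hω'
    have h1 := poincareForm_spec h ω hω x y
    have h2 := poincareForm_spec h ω hω y x
    have h3 := h.graded_comm _ _ x x.2 y y.2
    have h4 : Even (2 * k * (2 * k)) := ⟨2 * k * k, by ring⟩
    rw [h4.neg_one_pow, one_mul] at h3
    simp only
    rw [← h1, ← h2, h3]
  bijective := by
    have := h.finite (2 * k)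
    have hinj : Function.Injective (poincareForm h ω hω) := by
      rw [injective_iff_map_eq_zero]
      intro x hx
      apply Subtype.ext
      refine h.nondegenerate (2 * k) (2 * k) (by ring) x x.2 fun y hy => ?_
      have := poincareForm_spec h ω hω x ⟨y, hy⟩
      simpa [hx] using this
    exact ⟨hinj, (LinearMap.injective_iff_surjective_of_finrank_eq_finrank
      Subspace.dual_finrank_eq.symm).1 hinj⟩

/-- The integrality condition for a Poincaré duality algebra of formal dimension `4k`:
`(A^(2k), ·_ω) ∈ W(ℤ)` for some orientation `ω`. -/
def IsIntegral {A : Type v} [Ring A] [Algebra ℚ A] {𝒜 : ℕ → Submodule ℚ A} [GradedAlgebra 𝒜]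
    {k : ℕ} (h : IsPDA 𝒜 (4 * k)) : Prop :=
  ∃ (ω : 𝒜 (4 * k)) (hω : ω ≠ 0), MemWittInt (poincareForm h ω hω)

/-! ## Discriminants and local invariants -/

/-- `x ∈ ℚ*²`. -/
def IsNonzeroSquare (x : ℚ) : Prop := ∃ c : ℚ, c ≠ 0 ∧ x = c ^ 2

/-- The discriminant of the form `b` is `d` modulo `ℚ*²`: in every basis, the determinant of the
matrix of `b` equals `d` up to a factor in `ℚ*²`. -/
def HasDiscriminant {V : Type v} [AddCommGroup V] [Module ℚ V] (b : LinearMap.BilinForm ℚ V)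
    (d : ℚ) : Prop :=
  ∀ (n : ℕ) (e : Module.Basis (Fin n) ℚ V),
    ∃ c : ℚ, IsNonzeroSquare c ∧ (LinearMap.BilinForm.toMatrix e b).det = d * c

open Classical in
/-- The `p`-adic Hilbert symbol `(a, b)_p` of nonzero rational numbers `a` and `b`: it is `1` if
`z² = a x² + b y²` has a nonzero solution in `ℚ_p³`, and `-1` otherwise. -/
noncomputable def hilbertSymbol (p : ℕ) [Fact p.Prime] (a b : ℚ) : ℤ :=
  if ∃ x y z : ℚ_[p], (x, y, z) ≠ (0, 0, 0) ∧ z ^ 2 = (a : ℚ_[p]) * x ^ 2 + (b : ℚ_[p]) * y ^ 2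
  then 1 else -1

/-- The local invariant `ε_p = ∏_{i < j} (a_i, a_j)_p` of the diagonal form
`diag (a_1, …, a_r)`. -/
noncomputable def localInvariant (p : ℕ) [Fact p.Prime] {r : ℕ} (a : Fin r → ℚ) : ℤ :=
  ∏ i : Fin r, ∏ j ∈ Finset.Ioi i, hilbertSymbol p (a i) (a j)

end RatPDA

namespace RatPDA

universe u v w

open Submodule Module

/-! ### Duality for subgroups of the form lattice plus rational subspace. -/

section Lattices

variable {V : Type v} [AddCommGroup V] [Module ℚ V]

/-! The argument turns membership in `W(ℤ)` into the existence of a self-dual lattice, computes that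
existence prime by prime, and then studies how the local conditions move when the orientation is
rescaled.

A rational inner product space has its class in the image of `W(ℤ)` exactly when it contains a
self-dual ℤ-lattice (`memWittInt_iff`). The point is that adding or removing a split summand does
not affect this: a split space has a self-dual lattice, and a self-dual lattice in an orthogonal sum
with a split space descends to the other summand by cutting with `N^⊥` and dividing by `N`, where
`N` is a Lagrangian of the split space.

For a diagonal form with squarefree integral entries `α i`, the discriminant group of the standard
lattice has as its `p`-part a space over `ℤ/p`, which carries the residue form with entries `α i /
p` for `p ∣ α i`. A self-dual lattice exists iff each residue form has a Lagrangian
(`hasSelfDualLattice_diagForm_of_hasLagrangian` and its converse). At odd `p` this means that the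
rank is an even number `2 * t` and that `(-1) ^ t` times the determinant is a square. The tame
formula for the Hilbert symbol identifies the square condition with `ε_p = 1`. Even rank at every
prime follows from the determinant being a square up to sign, and at `p = 2` it suffices. This gives
`hasSelfDualLattice_diagForm_iff`.

Every other orientation multiplies the form by some rational `c`. Multiplying by `c` changes `ε_p`
by `(c, -1)_p ^ (r.choose 2) * (c, d)_p ^ (r - 1)`, where `d` is the determinant. For odd `r` the
discriminant condition forces `c` to be a square up to sign, and nothing changes at odd primes. For
even `r` and `d` a square up to sign, the factor is either trivial or `(c, -1)_p`. The latter is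
trivial for `p ≡ 1` mod 4, but can be prescribed through the valuation of `c` at the finitely many
bad `p ≡ 3` mod 4. -/

lemma exists_dual_notMem_one (A : Submodule ℤ V) [hA : IsLattice ℚ A] (P : Submodule ℚ V) {x : V}
    (hx : x ∉ A ⊔ P.restrictScalars ℤ) :
    ∃ φ : V →ₗ[ℚ] ℚ, (∀ c ∈ A, φ c ∈ (1 : Submodule ℤ ℚ)) ∧ (∀ y ∈ P, φ y = 0) ∧
      φ x ∉ (1 : Submodule ℤ ℚ) := by
  let f : V →ₗ[ℤ] V ⧸ P := P.mkQ.restrictScalars ℤ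
  have hL : IsLattice ℚ (A.map f) := by
    refine ⟨hA.fg.map f, ?_⟩
    have : ((A.map f : Submodule ℤ (V ⧸ P)) : Set (V ⧸ P)) = P.mkQ '' (A : Set V) := rfl
    rw [this, Submodule.span_image, hA.span_eq_top, Submodule.map_top, Submodule.range_mkQ]
  -- The image of `A` in `V ⧸ P` is a lattice. If every coordinate of the image of `x` in a ℤ-basis
  -- of it were integral, `x` would lie in `A + P`; so some coordinate functional, pulled back to
  -- `V`, separates.
  let c := Module.Free.chooseBasis ℤ (A.map f)
  let e := c.extendOfIsLattice ℚ
  by_contra! hcon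
  have key : ∀ i, e.repr (P.mkQ x) i ∈ (1 : Submodule ℤ ℚ) := by
    intro i
    refine hcon ((e.coord i) ∘ₗ P.mkQ) ?_ ?_
    · intro a ha
      obtain ⟨a', ha'⟩ : ∃ a' : A.map f, (a' : V ⧸ P) = P.mkQ a := ⟨⟨f a, a, ha, rfl⟩, rfl⟩
      rw [LinearMap.comp_apply, ← ha', ← c.sum_repr a']
      rw [Submodule.coe_sum, map_sum]
      refine sum_mem fun j _ => ?_
      rw [Submodule.coe_smul_of_tower, ← Module.Basis.extendOfIsLattice_apply ℚ c j,
        ← Int.cast_smul_eq_zsmul ℚ, map_smul, Module.Basis.coord_apply]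
      have h1 : (c.extendOfIsLattice ℚ).repr (c.extendOfIsLattice ℚ j) = Finsupp.single j 1 :=
        Module.Basis.repr_self _ _
      rw [show e = c.extendOfIsLattice ℚ from rfl, h1]
      refine Submodule.mem_one.2 ⟨c.repr a' j * (if j = i then 1 else 0), ?_⟩
      simp [Finsupp.single_apply]
    · intro y hy
      simp [(Submodule.Quotient.mk_eq_zero P).2 hy]
  apply hx
  have hmem : P.mkQ x ∈ A.map f := by
    rw [← e.sum_repr (P.mkQ x)]
    refine sum_mem fun j _ => ?_
    obtain ⟨n, hn⟩ := Submodule.mem_one.1 (key j)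
    rw [← hn, algebraMap_smul]
    refine Submodule.smul_mem _ _ ?_
    rw [show e j = (c j : V ⧸ P) from Module.Basis.extendOfIsLattice_apply ℚ c j]
    exact (c j).2
  obtain ⟨a, ha, hax⟩ := hmem
  have : x - a ∈ P := by
    rw [← Submodule.Quotient.mk_eq_zero, Submodule.Quotient.mk_sub, sub_eq_zero]
    exact hax.symm
  rw [show x = a + (x - a) by abel]
  exact Submodule.add_mem_sup ha this

variable {b : LinearMap.BilinForm ℚ V}

lemma dualSubmodule_anti {M N : Submodule ℤ V} (h : M ≤ N) :
    b.dualSubmodule N ≤ b.dualSubmodule M :=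
  fun _ hx y hy => hx y (h hy)

lemma dualSubmodule_sup (M N : Submodule ℤ V) :
    b.dualSubmodule (M ⊔ N) = b.dualSubmodule M ⊓ b.dualSubmodule N := by
  apply le_antisymm
  · exact le_inf (dualSubmodule_anti le_sup_left) (dualSubmodule_anti le_sup_right)
  · rintro x ⟨h1, h2⟩ y hy
    obtain ⟨m, hm, n, hn, rfl⟩ := Submodule.mem_sup.1 hy
    rw [map_add]
    exact add_mem (h1 m hm) (h2 n hn)

lemma mem_one_of_forall_mul_mem_one {q : ℚ} (h : ∀ c : ℚ, c * q ∈ (1 : Submodule ℤ ℚ)) : q = 0 := by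
  by_contra hq
  -- The multiplier is chosen so that the product is `1 / 2`.
  obtain ⟨n, hn⟩ := Submodule.mem_one.1 (h (1 / 2 * q⁻¹))
  have h2 : ((2 * n : ℤ) : ℚ) = 1 := by
    push_cast
    have : (n : ℚ) = 1 / 2 * q⁻¹ * q := by simpa using hn
    rw [this, mul_assoc, inv_mul_cancel₀ hq]; norm_num
  have : 2 * n = 1 := by exact_mod_cast h2
  omega

lemma dualSubmodule_restrictScalars (P : Submodule ℚ V) {x : V} :
    x ∈ b.dualSubmodule (P.restrictScalars ℤ) ↔ ∀ y ∈ P, b x y = 0 := by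
  refine ⟨fun h y hy => mem_one_of_forall_mul_mem_one fun c => ?_, fun h y hy => ?_⟩
  · rw [← smul_eq_mul, ← map_smul]
    exact h _ (P.smul_mem c hy)
  · rw [h y hy]; exact zero_mem _

/-- Biduality persists when a rational subspace is added to a lattice: a separating functional is
integral on `A`, zero on `P`, and by nondegeneracy is represented by a vector of the dual. This
replaces index computations in all later uses. -/
lemma dualSubmodule_dualSubmodule_sup [FiniteDimensional ℚ V] (hb : b.Nondegenerate)
    (hs : b.IsSymm) (A : Submodule ℤ V) [IsLattice ℚ A] (P : Submodule ℚ V) :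
    b.dualSubmodule (b.dualSubmodule (A ⊔ P.restrictScalars ℤ)) = A ⊔ P.restrictScalars ℤ := by
  apply le_antisymm
  · intro x hx
    by_contra hxn
    obtain ⟨φ, h1, h2, h3⟩ := exists_dual_notMem_one A P hxn
    obtain ⟨y, rfl⟩ : ∃ y, b y = φ := ⟨(b.toDual hb).symm φ, by
      ext z; exact LinearMap.BilinForm.apply_toDual_symm_apply φ z⟩
    apply h3
    rw [hs.eq y x]
    refine hx y ?_
    rw [dualSubmodule_sup]
    exact ⟨h1, (dualSubmodule_restrictScalars P).2 h2⟩
  · intro x hx y hy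
    rw [hs.eq x y]
    exact hy x hx

end Lattices

/-! ### Self-dual lattices: isometries, orthogonal sums, and cancellation of split spaces. -/

section SelfDual

variable {V : Type v} [AddCommGroup V] [Module ℚ V] {V' : Type w} [AddCommGroup V'] [Module ℚ V']
  {b : LinearMap.BilinForm ℚ V} {b' : LinearMap.BilinForm ℚ V'}

/-- `(V, b)` contains a unimodular `ℤ`-lattice. -/
def HasSelfDualLattice (b : LinearMap.BilinForm ℚ V) : Prop :=
  ∃ U : Submodule ℤ V, IsLattice ℚ U ∧ b.dualSubmodule U = U

lemma IsInnerProductSpace.nondegenerate (h : IsInnerProductSpace b) : b.Nondegenerate := by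
  refine ⟨fun x hx => ?_, fun x hx => ?_⟩
  · exact h.bijective.1 (by ext y; simpa using hx y)
  · exact h.bijective.1 (by ext y; rw [h.symm.eq x y]; simpa using hx y)

lemma orthogonalSum_apply (x y : V × V') :
    orthogonalSum b b' x y = b x.1 y.1 + b' x.2 y.2 := rfl

lemma orthogonalSum_isSymm (h : b.IsSymm) (h' : b'.IsSymm) : (orthogonalSum b b').IsSymm := by
  constructor
  intro x y
  simp [orthogonalSum_apply, h.eq x.1 y.1, h'.eq x.2 y.2]

lemma orthogonalSum_nondegenerate (h : b.Nondegenerate) (h' : b'.Nondegenerate) :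
    (orthogonalSum b b').Nondegenerate := by
  refine ⟨fun x hx => Prod.ext (h.1 _ fun y => ?_) (h'.1 _ fun y => ?_),
    fun x hx => Prod.ext (h.2 _ fun y => ?_) (h'.2 _ fun y => ?_)⟩
  · simpa [orthogonalSum_apply] using hx (y, 0)
  · simpa [orthogonalSum_apply] using hx (0, y)
  · simpa [orthogonalSum_apply] using hx (y, 0)
  · simpa [orthogonalSum_apply] using hx (0, y)

lemma exists_zsmul_mem (A : Submodule ℤ V) [hA : IsLattice ℚ A] (x : V) :
    ∃ n : ℤ, n ≠ 0 ∧ n • x ∈ A := by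
  have hx : x ∈ span ℚ (A : Set V) := by rw [hA.span_eq_top]; trivial
  induction hx using Submodule.span_induction with
  | mem y hy => exact ⟨1, one_ne_zero, by simpa using hy⟩
  | zero => exact ⟨1, one_ne_zero, by simp⟩
  | add y z _ _ hy hz =>
    obtain ⟨m, hm, hm'⟩ := hy
    obtain ⟨n, hn, hn'⟩ := hz
    refine ⟨m * n, mul_ne_zero hm hn, ?_⟩
    rw [smul_add]
    refine add_mem ?_ ?_
    · rw [mul_comm, mul_smul]; exact A.smul_mem _ hm'
    · rw [mul_smul]; exact A.smul_mem _ hn'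
  | smul c y _ hy =>
    obtain ⟨m, hm, hm'⟩ := hy
    refine ⟨c.den * m, mul_ne_zero (by exact_mod_cast c.den_ne_zero) hm, ?_⟩
    have : ((c.den : ℤ) * m) • c • y = c.num • m • y := by
      simp only [← Int.cast_smul_eq_zsmul ℚ, smul_smul]
      congr 1
      push_cast
      rw [mul_right_comm, Rat.den_mul_eq_num, mul_comm]
    rw [this]
    exact A.smul_mem _ hm'

lemma isLattice_of_forall_exists {A : Submodule ℤ V} (hfg : A.FG)
    (h : ∀ x : V, ∃ n : ℤ, n ≠ 0 ∧ n • x ∈ A) : IsLattice ℚ A := by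
  refine ⟨hfg, eq_top_iff.2 fun x _ => ?_⟩
  obtain ⟨n, hn, hx⟩ := h x
  have : x = (n : ℚ)⁻¹ • n • x := by
    rw [← Int.cast_smul_eq_zsmul ℚ, smul_smul, inv_mul_cancel₀ (by exact_mod_cast hn), one_smul]
  rw [this]
  exact Submodule.smul_mem _ _ (subset_span hx)

lemma isLattice_span_of_basis {ι : Type*} [Finite ι] (e : Basis ι ℚ V) :
    IsLattice ℚ (span ℤ (Set.range e)) := by
  refine ⟨Submodule.fg_span (Set.finite_range e), ?_⟩
  rw [Submodule.span_span_of_tower, e.span_eq]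

lemma exists_basis_eq_span [FiniteDimensional ℚ V] (A : Submodule ℤ V) [hA : IsLattice ℚ A] :
    ∃ e : Basis (Fin (finrank ℚ V)) ℚ V, A = span ℤ (Set.range e) := by
  let c₀ := Module.Free.chooseBasis ℤ A
  let c := c₀.reindex (Fintype.equivFinOfCardEq
    (Module.finrank_eq_card_basis (c₀.extendOfIsLattice ℚ)).symm)
  refine ⟨c.extendOfIsLattice ℚ, ?_⟩
  have h2 := congrArg (Submodule.map A.subtype) c.span_eq
  rw [Submodule.map_span, Submodule.map_top, Submodule.range_subtype, ← Set.range_comp] at h2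
  refine h2.symm.trans ?_
  congr 2
  ext j
  exact (Module.Basis.extendOfIsLattice_apply ℚ c j).symm

lemma isLattice_dualSubmodule [FiniteDimensional ℚ V] (hb : b.Nondegenerate) (A : Submodule ℤ V)
    [hA : IsLattice ℚ A] : IsLattice ℚ (b.dualSubmodule A) := by
  obtain ⟨e, rfl⟩ := exists_basis_eq_span A
  rw [LinearMap.BilinForm.dualSubmodule_span_of_basis _ hb]
  exact isLattice_span_of_basis _

/-- Any lattice becomes integral after multiplication by an integer that clears the denominators of
the form on it. -/
lemma exists_integral_lattice [FiniteDimensional ℚ V] (hb : b.Nondegenerate) :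
    ∃ A : Submodule ℤ V, IsLattice ℚ A ∧ A ≤ b.dualSubmodule A := by
  let A₀ := span ℤ (Set.range (Module.finBasis ℚ V))
  have hA₀ : IsLattice ℚ A₀ := isLattice_span_of_basis _
  have hD := isLattice_dualSubmodule hb A₀
  have : ∃ n : ℤ, n ≠ 0 ∧ ∀ x ∈ A₀, n • x ∈ b.dualSubmodule A₀ := by
    choose n hn hn' using fun i => exists_zsmul_mem (b.dualSubmodule A₀) (Module.finBasis ℚ V i)
    refine ⟨∏ i, n i, Finset.prod_ne_zero_iff.2 fun i _ => hn i, fun x hx => ?_⟩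
    induction hx using Submodule.span_induction with
    | mem y hy =>
      obtain ⟨i, rfl⟩ := hy
      rw [← Finset.prod_erase_mul _ _ (Finset.mem_univ i), mul_smul]
      exact Submodule.smul_mem _ _ (hn' i)
    | zero => simp
    | add y z _ _ hy hz => rw [smul_add]; exact add_mem hy hz
    | smul c y _ hy => rw [smul_comm]; exact Submodule.smul_mem _ _ hy
  obtain ⟨n, hn, hn'⟩ := this
  refine ⟨A₀.map (LinearMap.lsmul ℤ V n), isLattice_of_forall_exists (hA₀.fg.map _) fun x => ?_, ?_⟩
  · obtain ⟨m, hm, hx⟩ := exists_zsmul_mem A₀ x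
    exact ⟨n * m, mul_ne_zero hn hm, m • x, hx, (mul_smul n m x).symm⟩
  · rintro _ ⟨x, hx, rfl⟩ _ ⟨y, hy, rfl⟩
    rw [LinearMap.lsmul_apply, LinearMap.lsmul_apply, map_zsmul]
    exact Submodule.smul_mem _ _ (hn' x hx y hy)

lemma mem_iff_of_orthogonal_eq (hs : b.IsSymm) {N : Submodule ℚ V} (hN : b.orthogonal N = N)
    {x : V} : x ∈ N ↔ ∀ y ∈ N, b x y = 0 := by
  conv_lhs => rw [← hN]
  rw [LinearMap.BilinForm.mem_orthogonal_iff]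
  exact forall₂_congr fun y _ => by rw [hs.eq x y]

/-- Let `N` be the Lagrangian, `A` an integral lattice and `A'` its dual. The lattice `(A' ∩ N) + A`
is self-dual: by biduality the dual of `A' ∩ N` is `A + N`, so the dual of the sum is `(A + N) ∩
A'`, and the modular law with `A ≤ A'` returns the same lattice. -/
lemma IsSplit.hasSelfDualLattice (h : IsSplit b) : HasSelfDualLattice b := by
  have := h.finite
  have hb := h.toIsInnerProductSpace.nondegenerate
  obtain ⟨N, -, -, hN⟩ := h.exists_summand
  obtain ⟨A, hA, hAi⟩ := exists_integral_lattice hb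
  have hDA := isLattice_dualSubmodule hb A
  have hNmem := fun x => mem_iff_of_orthogonal_eq h.symm hN (x := x)
  have hNd : b.dualSubmodule (N.restrictScalars ℤ) = N.restrictScalars ℤ := by
    ext x
    rw [dualSubmodule_restrictScalars, ← hNmem]; rfl
  refine ⟨(b.dualSubmodule A ⊓ N.restrictScalars ℤ) ⊔ A, ?_, ?_⟩
  · refine IsLattice.of_le_of_isLattice_of_fg ℚ le_sup_right (Submodule.FG.sup ?_ hA.fg)
    have : IsNoetherian ℤ (b.dualSubmodule A ⊓ N.restrictScalars ℤ : Submodule ℤ V) :=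
      isNoetherian_of_le inf_le_left
    rw [← Module.Finite.iff_fg]
    infer_instance
  · have h1 : b.dualSubmodule (b.dualSubmodule A ⊓ N.restrictScalars ℤ) =
        A ⊔ N.restrictScalars ℤ := by
      rw [← dualSubmodule_dualSubmodule_sup hb h.symm, dualSubmodule_sup, hNd]
    rw [dualSubmodule_sup, h1]
    rw [← sup_comm A, sup_inf_assoc_of_le _ hAi, inf_comm (N.restrictScalars ℤ)]

lemma dualSubmodule_map_of_isometry (f : V ≃ₗ[ℚ] V') (hf : ∀ x y, b' (f x) (f y) = b x y)
    (U : Submodule ℤ V) :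
    b'.dualSubmodule (U.map (f.restrictScalars ℤ : V →ₗ[ℤ] V')) =
      (b.dualSubmodule U).map (f.restrictScalars ℤ : V →ₗ[ℤ] V') := by
  ext x
  constructor
  · intro hx
    refine ⟨f.symm x, fun y hy => ?_, by simp⟩
    rw [← hf, f.apply_symm_apply]
    exact hx _ ⟨y, hy, rfl⟩
  · rintro ⟨z, hz, rfl⟩ _ ⟨y, hy, rfl⟩
    have := hz y hy
    rw [← hf] at this
    exact this

lemma HasSelfDualLattice.of_isometry (f : V ≃ₗ[ℚ] V') (hf : ∀ x y, b' (f x) (f y) = b x y)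
    (h : HasSelfDualLattice b) : HasSelfDualLattice b' := by
  obtain ⟨U, hU, hU'⟩ := h
  refine ⟨U.map (f.restrictScalars ℤ : V →ₗ[ℤ] V'),
    isLattice_of_forall_exists (hU.fg.map _) fun x => ?_, ?_⟩
  · obtain ⟨n, hn, hx⟩ := exists_zsmul_mem U (f.symm x)
    exact ⟨n, hn, _, hx, by simp⟩
  · rw [dualSubmodule_map_of_isometry f hf, hU']

lemma hasSelfDualLattice_iff_of_isometry (f : V ≃ₗ[ℚ] V') (hf : ∀ x y, b' (f x) (f y) = b x y) :
    HasSelfDualLattice b ↔ HasSelfDualLattice b' :=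
  ⟨HasSelfDualLattice.of_isometry f hf, HasSelfDualLattice.of_isometry f.symm fun x y => by
    rw [← hf, f.apply_symm_apply, f.apply_symm_apply]⟩

lemma HasSelfDualLattice.orthogonalSum (h : HasSelfDualLattice b) (h' : HasSelfDualLattice b') :
    HasSelfDualLattice (orthogonalSum b b') := by
  obtain ⟨U, hU, hUd⟩ := h
  obtain ⟨U', hU', hUd'⟩ := h'
  refine ⟨U.prod U', isLattice_of_forall_exists (hU.fg.prod hU'.fg) fun x => ?_, ?_⟩
  · obtain ⟨n, hn, hx⟩ := exists_zsmul_mem U x.1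
    obtain ⟨m, hm, hx'⟩ := exists_zsmul_mem U' x.2
    refine ⟨m * n, mul_ne_zero hm hn, ?_, ?_⟩
    · rw [mul_smul]; exact U.smul_mem _ hx
    · rw [mul_comm, mul_smul]; exact U'.smul_mem _ hx'
  · ext x
    constructor
    · intro hx
      refine ⟨?_, ?_⟩
      · rw [SetLike.mem_coe, ← hUd]
        intro y hy
        simpa [orthogonalSum_apply] using hx (y, 0) ⟨hy, zero_mem _⟩
      · rw [SetLike.mem_coe, ← hUd']
        intro y hy
        simpa [orthogonalSum_apply] using hx (0, y) ⟨zero_mem _, hy⟩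
    · rintro ⟨h1, h2⟩ y ⟨hy1, hy2⟩
      rw [SetLike.mem_coe, ← hUd] at h1
      rw [SetLike.mem_coe, ← hUd'] at h2
      exact add_mem (h1 _ hy1) (h2 _ hy2)

/-- Sublagrangian reduction along `P = 0 × N`, whose orthogonal complement is `Q = V × N`. The
quotient `Q / P` is `V`, and the image of `U ∩ Q` in it is self-dual because the dual of `U ∩ Q` is
`U + P`. -/
lemma HasSelfDualLattice.of_orthogonalSum_isSplit (hb : IsInnerProductSpace b) (hb' : IsSplit b')
    (h : HasSelfDualLattice (RatPDA.orthogonalSum b b')) : HasSelfDualLattice b := by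
  have := hb.finite
  have := hb'.finite
  have hnd := orthogonalSum_nondegenerate hb.nondegenerate hb'.nondegenerate
  have hsymm := orthogonalSum_isSymm hb.symm hb'.symm
  obtain ⟨U, hU, hUd⟩ := h
  obtain ⟨N, -, -, hN⟩ := hb'.exists_summand
  have hNmem := fun x => mem_iff_of_orthogonal_eq hb'.symm hN (x := x)
  let P : Submodule ℚ (V × V') := Submodule.prod ⊥ N
  let Q : Submodule ℤ (V × V') := (Submodule.prod ⊤ N : Submodule ℚ (V × V')).restrictScalars ℤ
  have hP : (RatPDA.orthogonalSum b b').dualSubmodule (P.restrictScalars ℤ) = Q := by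
    ext x
    rw [dualSubmodule_restrictScalars]
    constructor
    · intro hx
      refine ⟨trivial, (hNmem _).2 fun y hy => ?_⟩
      simpa [orthogonalSum_apply] using hx (0, y) ⟨zero_mem _, hy⟩
    · rintro ⟨-, hx⟩ ⟨y, z⟩ ⟨hy, hz⟩
      obtain rfl : y = 0 := hy
      simpa [orthogonalSum_apply] using (hNmem _).1 hx z hz
  have key : (RatPDA.orthogonalSum b b').dualSubmodule (U ⊓ Q) = U ⊔ P.restrictScalars ℤ := by
    rw [← dualSubmodule_dualSubmodule_sup hnd hsymm, dualSubmodule_sup, hP, hUd]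
  refine ⟨(U ⊓ Q).map (LinearMap.fst ℤ V V'), isLattice_of_forall_exists ?_ fun x => ?_, ?_⟩
  · refine Submodule.FG.map _ ?_
    have : IsNoetherian ℤ (U ⊓ Q : Submodule ℤ (V × V')) := isNoetherian_of_le inf_le_left
    rw [← Module.Finite.iff_fg]
    infer_instance
  · obtain ⟨n, hn, hx⟩ := exists_zsmul_mem U (x, 0)
    exact ⟨n, hn, _, ⟨hx, trivial, by simp⟩, rfl⟩
  · ext x
    constructor
    · intro hx
      have h1 : ((x, 0) : V × V') ∈ (RatPDA.orthogonalSum b b').dualSubmodule (U ⊓ Q) := by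
        rintro y hy
        simpa [orthogonalSum_apply] using hx y.1 ⟨y, hy, rfl⟩
      rw [key] at h1
      obtain ⟨u, hu, ⟨q, n⟩, ⟨hq, hn⟩, hun⟩ := Submodule.mem_sup.1 h1
      obtain rfl : q = 0 := hq
      have h2 : u = (x, -n) := by
        rw [eq_sub_of_add_eq hun]; simp
      exact ⟨u, ⟨hu, trivial, by rw [h2]; exact N.neg_mem hn⟩, by rw [h2]; rfl⟩
    · rintro ⟨u, ⟨hu, -, hu2⟩, rfl⟩ _ ⟨w, ⟨hw, -, hw2⟩, rfl⟩
      have h1 : RatPDA.orthogonalSum b b' u w ∈ (1 : Submodule ℤ ℚ) := by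
        rw [← hUd] at hu
        exact hu w hw
      rw [orthogonalSum_apply, (hNmem _).1 hu2 _ hw2, add_zero] at h1
      exact h1

end SelfDual

/-! ### Classes from `W(ℤ)` correspond to self-dual lattices. -/

section WittInt

variable {V : Type v} [AddCommGroup V] [Module ℚ V] {b : LinearMap.BilinForm ℚ V}

lemma IsInnerProductSpace.hasSelfDualLattice_baseChange {L : Type w} [AddCommGroup L]
    {β : LinearMap.BilinForm ℤ L} (h : IsInnerProductSpace β) :
    HasSelfDualLattice (LinearMap.BilinForm.baseChange ℚ β) := by
  have := h.finite
  have := h.projective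
  have : Module.Free ℤ L := by
    have : IsTorsionFree ℤ L := inferInstance
    infer_instance
  let c := Module.Free.chooseBasis ℤ L
  let e : Basis _ ℚ (ℚ ⊗[ℤ] L) := c.baseChange ℚ
  have he : ∀ i, e i = 1 ⊗ₜ c i := fun i => c.baseChange_apply ℚ i
  refine ⟨span ℤ (Set.range e), isLattice_span_of_basis e, ?_⟩
  have hmem : ∀ l : L, (1 : ℚ) ⊗ₜ[ℤ] l ∈ span ℤ (Set.range e) := by
    intro l
    rw [← c.sum_repr l, TensorProduct.tmul_sum]
    refine sum_mem fun i _ => ?_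
    rw [TensorProduct.tmul_smul, ← he]
    exact Submodule.smul_mem _ _ (subset_span ⟨i, rfl⟩)
  apply le_antisymm
  · intro x hx
    -- Unimodularity represents each coordinate functional by a vector `l i` of `L`; pairing with it
    -- reads off the `i`-th coordinate, so a vector of the dual has integral coordinates.
    choose l hl using fun i => h.bijective.2 (c.coord i)
    have hxl : ∀ i, LinearMap.BilinForm.baseChange ℚ β x (1 ⊗ₜ l i) = e.repr x i := by
      intro i
      conv_lhs => rw [← e.sum_repr x]
      simp only [map_sum, map_smul, LinearMap.sum_apply, LinearMap.smul_apply, he,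
        LinearMap.BilinForm.baseChange_tmul]
      have : ∀ j, β (c j) (l i) = if j = i then 1 else 0 := by
        intro j
        rw [h.symm.eq, hl]
        simp [Finsupp.single_apply]
      simp [this]
    rw [← e.sum_repr x]
    refine sum_mem fun i _ => ?_
    obtain ⟨n, hn⟩ := Submodule.mem_one.1 (hx _ (hmem (l i)))
    rw [← hxl, ← hn, algebraMap_smul]
    exact Submodule.smul_mem _ _ (subset_span ⟨i, rfl⟩)
  · rw [Submodule.span_le]
    rintro _ ⟨i, rfl⟩ y hy
    induction hy using Submodule.span_induction with
    | mem y hy =>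
      obtain ⟨j, rfl⟩ := hy
      rw [he, he, LinearMap.BilinForm.baseChange_tmul]
      exact Submodule.mem_one.2 ⟨β (c i) (c j), by simp⟩
    | zero => simp
    | add y z _ _ hy hz => rw [map_add]; exact add_mem hy hz
    | smul c y _ hy => rw [map_zsmul]; exact Submodule.smul_mem _ _ hy

lemma isSplit_punit {R : Type u} [CommRing R] :
    IsSplit (0 : LinearMap.BilinForm R PUnit.{v + 1}) where
  finite := inferInstance
  projective := inferInstance
  symm := LinearMap.BilinForm.isSymm_zero
  bijective := by
    refine ⟨fun _ _ _ => Subsingleton.elim _ _, fun f => ⟨0, ?_⟩⟩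
    ext x
    rw [Subsingleton.elim x 0, map_zero, map_zero]
  exists_summand := ⟨⊤, ⊥, isCompl_top_bot, Subsingleton.elim _ _⟩

lemma WittEquiv.of_isometry {R : Type u} [CommRing R] {M : Type v} [AddCommGroup M] [Module R M]
    {M' : Type w} [AddCommGroup M'] [Module R M'] {b : LinearMap.BilinForm R M}
    {b' : LinearMap.BilinForm R M'} (f : M ≃ₗ[R] M') (hf : ∀ x y, b' (f x) (f y) = b x y) :
    WittEquiv b b' :=
  ⟨PUnit, PUnit, inferInstance, inferInstance, inferInstance, inferInstance, 0, 0, isSplit_punit,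
    isSplit_punit, ⟨⟨f.prodCongr (LinearEquiv.refl R PUnit.{u + 1}), fun x y => by
      simp [orthogonalSum, hf]⟩⟩⟩

lemma exists_gram_matrix {n : ℕ} {e : Basis (Fin n) ℚ V}
    (h : b.dualSubmodule (span ℤ (Set.range e)) = span ℤ (Set.range e)) :
    ∃ G : Matrix (Fin n) (Fin n) ℤ, ∀ i j, b (e i) (e j) = G i j := by
  have : ∀ i j, ∃ n : ℤ, b (e i) (e j) = n := by
    intro i j
    have h1 : e i ∈ b.dualSubmodule (span ℤ (Set.range e)) := by
      rw [h]; exact subset_span ⟨i, rfl⟩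
    obtain ⟨n, hn⟩ := Submodule.mem_one.1 (h1 (e j) (subset_span ⟨j, rfl⟩))
    exact ⟨n, hn.symm⟩
  choose G hG using this
  exact ⟨G, hG⟩

/-- The integral Gram matrix of a self-dual lattice defines an inner product space over ℤ whose base
change is isometric to `b`; no split summand is needed. -/
lemma HasSelfDualLattice.memWittInt (hb : IsInnerProductSpace b) (h : HasSelfDualLattice b) :
    MemWittInt b := by
  have := hb.finite
  obtain ⟨U, hU, hUd⟩ := h
  obtain ⟨e, rfl⟩ := exists_basis_eq_span U
  obtain ⟨G, hG⟩ := exists_gram_matrix hUd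
  let β : LinearMap.BilinForm ℤ (Fin (finrank ℚ V) → ℤ) := Matrix.toBilin' G
  let j : (Fin (finrank ℚ V) → ℤ) → V := fun x => ∑ i, x i • e i
  have hβ : ∀ x y, ((β x y : ℤ) : ℚ) = b (j x) (j y) := by
    intro x y
    simp only [β, j, Matrix.toBilin'_apply, map_sum, LinearMap.sum_apply, map_zsmul,
      LinearMap.smul_apply, hG, zsmul_eq_mul]
    push_cast
    rw [Finset.sum_comm]
    refine Finset.sum_congr rfl fun i _ => ?_
    rw [Finset.mul_sum]
    exact Finset.sum_congr rfl fun k _ => mul_comm _ _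
  have hjs : ∀ i, j (Pi.single i 1) = e i := by
    intro i
    simp [j]
  have hsymm : β.IsSymm := ⟨fun x y => by
    have : ((β x y : ℤ) : ℚ) = β y x := by rw [hβ, hβ, hb.symm.eq]
    exact_mod_cast this⟩
  have hinj : ∀ x, j x = 0 → x = 0 := by
    intro x hx
    ext i
    have := congrArg (fun v => e.repr v i) hx
    simpa [j, ← Int.cast_smul_eq_zsmul ℚ, Finsupp.single_apply] using this
  refine ⟨Fin (finrank ℚ V) → ℤ, inferInstance, β, ⟨inferInstance, inferInstance, hsymm, ?_, ?_⟩, ?_⟩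
  · rw [injective_iff_map_eq_zero]
    intro x hx
    refine hinj x (hb.bijective.1 ?_)
    rw [map_zero]
    refine e.ext fun i => ?_
    rw [← hjs, ← hβ, hx]
    simp
  · intro φ
    obtain ⟨v, hv⟩ := hb.bijective.2 (e.constr ℚ fun i => ((φ (Pi.single i 1) : ℤ) : ℚ))
    have hve : ∀ i, b v (e i) = (φ (Pi.single i 1) : ℤ) := fun i => by
      rw [hv, e.constr_basis]
    have hvU : v ∈ span ℤ (Set.range e) := by
      rw [← hUd]
      intro y hy
      induction hy using Submodule.span_induction with
      | mem y hy =>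
        obtain ⟨i, rfl⟩ := hy
        exact Submodule.mem_one.2 ⟨_, (hve i).symm⟩
      | zero => simp
      | add y z _ _ hy hz => rw [map_add]; exact add_mem hy hz
      | smul c y _ hy => rw [map_zsmul]; exact Submodule.smul_mem _ _ hy
    obtain ⟨x, hx⟩ := (Submodule.mem_span_range_iff_exists_fun ℤ).1 hvU
    refine ⟨x, (Pi.basisFun ℤ _).ext fun i => ?_⟩
    rw [Pi.basisFun_apply]
    have : ((β x (Pi.single i 1) : ℤ) : ℚ) = (φ (Pi.single i 1) : ℤ) := by
      rw [hβ, hjs, ← hve, ← hx]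
    exact_mod_cast this
  · refine WittEquiv.of_isometry (((Pi.basisFun ℤ _).baseChange ℚ).equiv e (Equiv.refl _)) ?_
    intro x y
    have : (b.compl₁₂ (((Pi.basisFun ℤ _).baseChange ℚ).equiv e (Equiv.refl _)).toLinearMap
        (((Pi.basisFun ℤ _).baseChange ℚ).equiv e (Equiv.refl _)).toLinearMap) =
        LinearMap.BilinForm.baseChange ℚ β := by
      refine LinearMap.BilinForm.ext_basis ((Pi.basisFun ℤ _).baseChange ℚ) fun i k => ?_
      rw [LinearMap.compl₁₂_apply, LinearEquiv.coe_coe, Basis.equiv_apply, Basis.equiv_apply,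
        Basis.baseChange_apply, Basis.baseChange_apply, LinearMap.BilinForm.baseChange_tmul]
      simp only [Equiv.refl_apply, Pi.basisFun_apply]
      rw [← hjs, ← hjs, ← hβ]
      simp
    rw [← this]
    rfl

lemma memWittInt_iff (hb : IsInnerProductSpace b) : MemWittInt b ↔ HasSelfDualLattice b := by
  refine ⟨?_, HasSelfDualLattice.memWittInt hb⟩
  rintro ⟨L, _, β, hβ, S, S', _, _, _, _, s, s', hs, hs', ⟨f⟩⟩
  exact HasSelfDualLattice.of_orthogonalSum_isSplit hb hs'
    ((hβ.hasSelfDualLattice_baseChange.orthogonalSum hs.hasSelfDualLattice).of_isometry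
      f.toLinearEquiv fun x y => f.map_app' x y)

/-- The Gram matrix of a self-dual lattice is invertible over ℤ, the inverse expressing the dual
basis; hence its determinant is `±1`, and a change of basis multiplies it by a square. -/
lemma HasSelfDualLattice.isNonzeroSquare_abs_det (hb : IsInnerProductSpace b)
    (h : HasSelfDualLattice b) {n : ℕ} (e : Basis (Fin n) ℚ V) :
    IsNonzeroSquare |(LinearMap.BilinForm.toMatrix e b).det| := by
  have := hb.finite
  obtain ⟨U, hU, hUd⟩ := h
  obtain ⟨c, rfl⟩ := exists_basis_eq_span U
  obtain rfl : n = finrank ℚ V := by simpa using (Module.finrank_eq_card_basis e).symm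
  obtain ⟨G, hG⟩ := exists_gram_matrix hUd
  obtain ⟨d, hd⟩ : ∃ d : Basis (Fin (finrank ℚ V)) ℚ V, ∀ i j, b (d i) (c j) = if j = i then 1 else 0 := by
    classical
    exact ⟨b.dualBasis hb.nondegenerate c, fun i j => by
      rw [LinearMap.BilinForm.apply_dualBasis_left]⟩
  have hdm : ∀ i, d i ∈ span ℤ (Set.range c) := by
    intro i
    rw [← hUd]
    intro y hy
    induction hy using Submodule.span_induction with
    | mem y hy =>
      obtain ⟨j, rfl⟩ := hy
      exact Submodule.mem_one.2 ⟨if j = i then 1 else 0, by rw [hd]; simp⟩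
    | zero => simp
    | add y z _ _ hy hz => rw [map_add]; exact add_mem hy hz
    | smul c y _ hy => rw [map_zsmul]; exact Submodule.smul_mem _ _ hy
  choose H hH using fun i => (Submodule.mem_span_range_iff_exists_fun ℤ).1 (hdm i)
  have hHG : Matrix.of H * G = 1 := by
    ext i j
    have h1 := hd i j
    rw [← hH i] at h1
    simp only [map_sum, LinearMap.sum_apply, map_zsmul, LinearMap.smul_apply, hG] at h1
    rw [Matrix.mul_apply, Matrix.one_apply]
    have : ((∑ k, H i k * G k j : ℤ) : ℚ) = ((if i = j then 1 else 0 : ℤ) : ℚ) := by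
      push_cast
      simpa [eq_comm] using h1
    exact_mod_cast this
  have hdet : |(G.det : ℚ)| = 1 := by
    have h1 : IsUnit G.det := IsUnit.of_mul_eq_one_right (Matrix.of H).det (by
      rw [← Matrix.det_mul, hHG, Matrix.det_one])
    rw [Int.isUnit_iff] at h1
    rcases h1 with h1 | h1 <;> simp [h1]
  have hGm : LinearMap.BilinForm.toMatrix c b = G.map (Int.castRingHom ℚ) := by
    ext i j
    simp [LinearMap.BilinForm.toMatrix_apply, hG]
  have h2 := LinearMap.BilinForm.toMatrix_mul_basis_toMatrix (B := b) c e
  refine ⟨(c.toMatrix e).det, ?_, ?_⟩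
  · intro h0
    have := congrArg Matrix.det (c.toMatrix_mul_toMatrix_flip e)
    rw [Matrix.det_mul, h0] at this
    simp at this
  · rw [← h2, Matrix.det_mul, Matrix.det_mul, Matrix.det_transpose, hGm,
      ← RingHom.mapMatrix_apply, ← RingHom.map_det, abs_mul, abs_mul]
    simp only [eq_intCast, hdet, mul_one]
    rw [abs_mul_abs_self, sq]

end WittInt

/-! ### The dual of the standard lattice and its reduction at a prime. -/

section Reduction

variable {ι : Type v} (α : ι → ℤ)

/-- The parametrization of the dual lattice of `ℤ^ι` for `⟨α_i⟩`. -/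
def dualParam : (ι → ℤ) →ₗ[ℤ] (ι → ℚ) where
  toFun η i := η i / α i
  map_add' η η' := by ext i; simp [add_div]
  map_smul' c η := by ext i; simp [mul_div_assoc]

/-- The reduction map from the dual lattice of `ℤ^ι` to the residue space at `p`. -/
def residueMap (p : ℕ) [Fact p.Prime] :
    (ι → ℤ) →ₗ[ℤ] ({i // (p : ℤ) ∣ α i} → ZMod p) where
  toFun η i := ((α i / p : ℤ) : ZMod p)⁻¹ * (η i : ZMod p)
  map_add' η η' := by ext i; simp [mul_add]
  map_smul' c η := by ext i; simp [mul_left_comm]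

variable {α}

lemma residue_ne_zero (hα : ∀ i, Squarefree (α i)) {p : ℕ} [Fact p.Prime] {i : ι}
    (hi : (p : ℤ) ∣ α i) : ((α i / p : ℤ) : ZMod p) ≠ 0 := by
  rw [Ne, ZMod.intCast_zmod_eq_zero_iff_dvd]
  rintro ⟨m, hm⟩
  have h1 : (p : ℤ) * p ∣ α i := ⟨m, by
    rw [← Int.mul_ediv_cancel' hi, hm, mul_assoc]⟩
  have h2 := hα i _ h1
  have h3 := (Nat.prime_iff_prime_int.1 (Fact.out : p.Prime)).not_isUnit
  exact h3 h2

/-- A lift of `h` along the reduction map. -/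
def residueLift (α : ι → ℤ) (p : ℕ) [Fact p.Prime] (h : {i // (p : ℤ) ∣ α i} → ZMod p) : ι → ℤ :=
  fun i => if hi : (p : ℤ) ∣ α i then α i / p * ((h ⟨i, hi⟩).val : ℤ) else 0

lemma residueMap_residueLift (hα : ∀ i, Squarefree (α i)) {p : ℕ} [Fact p.Prime]
    (h : {i // (p : ℤ) ∣ α i} → ZMod p) : residueMap α p (residueLift α p h) = h := by
  ext ⟨i, hi⟩
  have := residue_ne_zero hα hi
  simp only [residueMap, residueLift, LinearMap.coe_mk, AddHom.coe_mk, dif_pos hi]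
  push_cast
  rw [ZMod.natCast_zmod_val, inv_mul_cancel_left₀ this]

/-- The lift at `p` represents a vector with denominators dividing `p`, hence has trivial component
in the discriminant group at any other prime `q`. -/
lemma residueMap_residueLift_of_ne {p q : ℕ} [Fact p.Prime] [Fact q.Prime]
    (hpq : p ≠ q) (h : {i // (p : ℤ) ∣ α i} → ZMod p) :
    residueMap α q (residueLift α p h) = 0 := by
  ext ⟨i, hi⟩
  simp only [residueMap, residueLift, LinearMap.coe_mk, AddHom.coe_mk, Pi.zero_apply]
  split_ifs with hp
  · have : (q : ℤ) ∣ α i / p := by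
      rw [← Int.mul_ediv_cancel' hp] at hi
      refine ((Nat.prime_iff_prime_int.1 (Fact.out : q.Prime)).dvd_or_dvd hi).resolve_left ?_
      rw [Int.natCast_dvd_natCast, Nat.prime_dvd_prime_iff_eq Fact.out Fact.out]
      exact hpq.symm
    rw [(ZMod.intCast_zmod_eq_zero_iff_dvd _ q).2 (this.mul_right _), mul_zero]
  · simp

lemma residueMap_mul (p : ℕ) [Fact p.Prime] (η : ι → ℤ) :
    residueMap α p (fun i => α i * η i) = 0 := by
  ext ⟨i, hi⟩
  simp only [residueMap, LinearMap.coe_mk, AddHom.coe_mk, Pi.zero_apply]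
  rw [(ZMod.intCast_zmod_eq_zero_iff_dvd _ p).2 (hi.mul_right _), mul_zero]

lemma dualParam_mul (hα : ∀ i, Squarefree (α i)) (z : ι → ℤ) :
    dualParam α (fun i => α i * z i) = fun i => (z i : ℚ) := by
  ext i
  have : (α i : ℚ) ≠ 0 := by exact_mod_cast (hα i).ne_zero
  simp only [dualParam, LinearMap.coe_mk, AddHom.coe_mk]
  push_cast
  field_simp

end Reduction

/-! ### A self-dual lattice exists iff all residue forms have Lagrangians. -/

section DiagForm

/-- The diagonal form `⟨a_i⟩` on `ι → R`. -/
def diagForm {R : Type u} [CommRing R] {ι : Type v} [Fintype ι] (a : ι → R) :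
    LinearMap.BilinForm R (ι → R) :=
  LinearMap.mk₂ R (fun x y => ∑ i, a i * (x i * y i))
    (fun x x' y => by
      rw [← Finset.sum_add_distrib]
      exact Finset.sum_congr rfl fun i _ => by simp only [Pi.add_apply]; ring)
    (fun c x y => by
      rw [Finset.smul_sum]
      exact Finset.sum_congr rfl fun i _ => by simp only [Pi.smul_apply, smul_eq_mul]; ring)
    (fun x y y' => by
      rw [← Finset.sum_add_distrib]
      exact Finset.sum_congr rfl fun i _ => by simp only [Pi.add_apply]; ring)
    (fun c x y => by
      rw [Finset.smul_sum]
      exact Finset.sum_congr rfl fun i _ => by simp only [Pi.smul_apply, smul_eq_mul]; ring)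

variable {ι : Type v} [Fintype ι]

lemma diagForm_apply {R : Type u} [CommRing R] (a x y : ι → R) :
    diagForm a x y = ∑ i, a i * (x i * y i) := rfl

lemma diagForm_isSymm {R : Type u} [CommRing R] (a : ι → R) : (diagForm a).IsSymm :=
  ⟨fun x y => Finset.sum_congr rfl fun i _ => by ring⟩

lemma diagForm_single {R : Type u} [CommRing R] [DecidableEq ι] (a x : ι → R) (i : ι) :
    diagForm a x (Pi.single i 1) = a i * x i := by
  rw [diagForm_apply, Finset.sum_eq_single i]
  · simp
  · intro j _ hj; simp [hj]
  · simp

lemma diagForm_nondegenerate {F : Type u} [Field F] {a : ι → F} (ha : ∀ i, a i ≠ 0) :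
    (diagForm a).Nondegenerate := by
  classical
  have : ∀ x, (∀ y, diagForm a x y = 0) → x = 0 := fun x hx => by
    ext i
    have := hx (Pi.single i 1)
    rw [diagForm_single] at this
    exact (mul_eq_zero.1 this).resolve_left (ha i)
  exact ⟨this, fun x hx => this x fun y => by rw [(diagForm_isSymm a).eq x y]; exact hx y⟩

/-- `(V, b)` has a subspace equal to its own orthogonal complement. -/
def HasLagrangian {F : Type u} [Field F] {V : Type v} [AddCommGroup V] [Module F V]
    (b : LinearMap.BilinForm F V) : Prop :=
  ∃ H : Submodule F V, ∀ x, x ∈ H ↔ ∀ y ∈ H, b x y = 0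

variable (α : ι → ℤ)

/-- The residue form at `p` of `⟨α_i⟩`, for squarefree integers `α_i`: the form `⟨α_i / p⟩` over
`ℤ / p`, where `i` runs over the indices with `p ∣ α_i`. -/
def residueForm (p : ℕ) [Fact p.Prime] :
    LinearMap.BilinForm (ZMod p) ({i // (p : ℤ) ∣ α i} → ZMod p) :=
  diagForm fun i => ((α i / p : ℤ) : ZMod p)

variable {α}

lemma residueForm_apply_residueMap (hα : ∀ i, Squarefree (α i)) {p : ℕ} [Fact p.Prime]
    (h : {i // (p : ℤ) ∣ α i} → ZMod p) (η : ι → ℤ) :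
    residueForm α p h (residueMap α p η) = ∑ i, h i * (η i : ZMod p) := by
  refine Finset.sum_congr rfl fun i _ => ?_
  have := residue_ne_zero hα i.2
  simp only [residueMap, LinearMap.coe_mk, AddHom.coe_mk]
  field_simp

lemma sum_dite_zero {M : Type*} [AddCommMonoid M] (P : ι → Prop) [DecidablePred P]
    (f : ∀ i, P i → M) : ∑ i, (if h : P i then f i h else 0) = ∑ i : {i // P i}, f i i.2 := by
  rw [Finset.sum_dite, Finset.sum_const_zero, add_zero]
  have h := fun i (hi : i ∈ Finset.univ.filter P) => (Finset.mem_filter.1 hi).2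
  exact Finset.sum_bij' (fun i _ => ⟨i.1, h _ i.2⟩) (fun i _ => ⟨i.1, by simp [i.2]⟩)
    (by simp) (by simp) (by simp) (by simp) (by simp)

/-- The lift of `h` represents the vector with coordinates `(h i).val / p`, so its pairing with
`dualParam α η` is the sum of the `(h i).val * η i` divided by `p`, and that sum reduces to the
residue pairing. -/
lemma diagForm_dualParam_residueLift_mem_one_iff (hα : ∀ i, Squarefree (α i)) {p : ℕ}
    [Fact p.Prime] (h : {i // (p : ℤ) ∣ α i} → ZMod p) (η : ι → ℤ) :
    diagForm (fun i => (α i : ℚ)) (dualParam α (residueLift α p h)) (dualParam α η) ∈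
      (1 : Submodule ℤ ℚ) ↔ residueForm α p h (residueMap α p η) = 0 := by
  have hp : (p : ℚ) ≠ 0 := by exact_mod_cast (Fact.out : p.Prime).ne_zero
  have h0 : ∀ i, (α i : ℚ) ≠ 0 := fun i => by exact_mod_cast (hα i).ne_zero
  have h1 : diagForm (fun i => (α i : ℚ)) (dualParam α (residueLift α p h)) (dualParam α η) =
      ((∑ i : {i // (p : ℤ) ∣ α i}, ((h i).val : ℤ) * η i : ℤ) : ℚ) / p := by
    rw [diagForm_apply]
    have : ∀ i, (α i : ℚ) * (dualParam α (residueLift α p h) i * dualParam α η i) =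
        if hi : (p : ℤ) ∣ α i then (((h ⟨i, hi⟩).val : ℤ) * η i : ℚ) / p else 0 := by
      intro i
      simp only [dualParam, residueLift, LinearMap.coe_mk, AddHom.coe_mk]
      split_ifs with hi
      · have h2 : ((α i / p : ℤ) : ℚ) = α i / p := by
          rw [Int.cast_div hi (by exact_mod_cast hp)]; simp
        have := h0 i
        push_cast [h2]
        field_simp
      · simp
    rw [Finset.sum_congr rfl fun i _ => this i, sum_dite_zero]
    simp [Finset.sum_div]
  rw [h1, residueForm_apply_residueMap hα]
  have h2 : (∑ i, h i * (η i : ZMod p)) =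
      ((∑ i : {i // (p : ℤ) ∣ α i}, ((h i).val : ℤ) * η i : ℤ) : ZMod p) := by
    push_cast
    simp
  rw [h2, ZMod.intCast_zmod_eq_zero_iff_dvd, Submodule.mem_one]
  constructor
  · rintro ⟨n, hn⟩
    refine ⟨n, ?_⟩
    rw [eq_div_iff hp, eq_intCast] at hn
    rw [mul_comm]
    exact_mod_cast hn.symm
  · rintro ⟨n, hn⟩
    refine ⟨n, ?_⟩
    rw [hn, eq_div_iff hp]
    push_cast
    exact mul_comm _ _

/-- `p` times the pairing of two vectors of the dual lattice is `p`-integral and reduces to the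
residue pairing. The factor `N`, prime to `p`, clears the remaining denominators so that the
congruence can be stated between integers. -/
lemma exists_mul_diagForm_eq (hα : ∀ i, Squarefree (α i)) (p : ℕ) [Fact p.Prime]
    (η η' : ι → ℤ) : ∃ N K : ℤ, ¬ (p : ℤ) ∣ N ∧
      p * N * diagForm (fun i => (α i : ℚ)) (dualParam α η) (dualParam α η') = K ∧
      (K : ZMod p) = N * residueForm α p (residueMap α p η) (residueMap α p η') := by
  classical
  have hpp := Nat.prime_iff_prime_int.1 (Fact.out : p.Prime)
  have hp : (p : ℚ) ≠ 0 := by exact_mod_cast (Fact.out : p.Prime).ne_zero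
  have h0 : ∀ i, (α i : ℚ) ≠ 0 := fun i => by exact_mod_cast (hα i).ne_zero
  -- `n i` is the part of `α i` prime to `p`, and `c i` records that `p / α i = c i / n i`.
  let n : ι → ℤ := fun i => if (p : ℤ) ∣ α i then α i / p else α i
  let c : ι → ℤ := fun i => if (p : ℤ) ∣ α i then 1 else p
  have hn : ∀ i, p * n i = c i * α i := by
    intro i
    by_cases hi : (p : ℤ) ∣ α i
    · simp [n, c, hi, Int.mul_ediv_cancel' hi]
    · simp [n, c, hi]
  refine ⟨∏ i, n i, ∑ i, (∏ j ∈ Finset.univ.erase i, n j) * (c i * (η i * η' i)), ?_, ?_, ?_⟩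
  · rw [hpp.dvd_finsetProd_iff]
    rintro ⟨i, -, hi⟩
    by_cases h : (p : ℤ) ∣ α i
    · simp only [n, if_pos h] at hi
      exact residue_ne_zero hα h ((ZMod.intCast_zmod_eq_zero_iff_dvd _ p).2 hi)
    · simp only [n, if_neg h] at hi
      exact h hi
  · rw [diagForm_apply, Finset.mul_sum, Int.cast_sum]
    refine Finset.sum_congr rfl fun i _ => ?_
    rw [← Finset.mul_prod_erase _ _ (Finset.mem_univ i)]
    have h1 : (p : ℚ) * n i = c i * α i := by exact_mod_cast hn i
    have := h0 i
    simp only [dualParam, LinearMap.coe_mk, AddHom.coe_mk]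
    push_cast
    calc _ = (p * n i : ℚ) * (∏ j ∈ Finset.univ.erase i, (n j : ℚ)) * (η i * η' i) / α i := by
          field_simp
      _ = _ := by rw [h1]; field_simp
  · rw [residueForm_apply_residueMap hα, Finset.mul_sum]
    push_cast
    have : ∀ i, (∏ j ∈ Finset.univ.erase i, (n j : ZMod p)) * (c i * (η i * η' i)) =
        if hi : (p : ℤ) ∣ α i then (∏ j, (n j : ZMod p)) * (residueMap α p η ⟨i, hi⟩ * η' i)
          else 0 := by
      intro i
      split_ifs with hi
      · have h1 := residue_ne_zero hα hi
        rw [← Finset.mul_prod_erase _ _ (Finset.mem_univ i)]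
        simp only [n, c, if_pos hi, residueMap, LinearMap.coe_mk, AddHom.coe_mk]
        field_simp
        push_cast
        ring
      · simp [c, hi]
    rw [Finset.sum_congr rfl fun i _ => this i, sum_dite_zero]

lemma mem_one_of_forall_not_dvd {q : ℚ}
    (h : ∀ (p : ℕ) [Fact p.Prime], ∃ N K : ℤ, ¬ (p : ℤ) ∣ N ∧ (N : ℚ) * q = K) :
    q ∈ (1 : Submodule ℤ ℚ) := by
  suffices hd : q.den = 1 from Submodule.mem_one.2 ⟨q.num, by
    rw [eq_intCast]; exact Rat.coe_int_num_of_den_eq_one hd⟩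
  by_contra hd
  obtain ⟨p, hp, hpd⟩ := Nat.exists_prime_and_dvd hd
  have : Fact p.Prime := ⟨hp⟩
  obtain ⟨N, K, hN, hK⟩ := h p
  have h1 : (N : ℚ) * q.num = K * q.den := by
    rw [← hK, mul_assoc, Rat.mul_den_eq_num]
  have h2 : N * q.num = K * q.den := by exact_mod_cast h1
  have h3 : (p : ℤ) ∣ N * q.num := by
    rw [h2]
    exact (Int.natCast_dvd_natCast.2 hpd).mul_left _
  rcases (Nat.prime_iff_prime_int.1 hp).dvd_or_dvd h3 with h4 | h4
  · exact hN h4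
  · have h5 : p ∣ q.num.natAbs := Int.natCast_dvd.1 h4
    exact hp.one_lt.ne' (Nat.dvd_one.1 (q.reduced ▸ Nat.dvd_gcd h5 hpd))

lemma exists_eq_dualParam (hα : ∀ i, Squarefree (α i)) {x : ι → ℚ}
    (h : ∀ z : ι → ℤ, diagForm (fun i => (α i : ℚ)) x (fun i => (z i : ℚ)) ∈ (1 : Submodule ℤ ℚ)) :
    ∃ η, x = dualParam α η := by
  classical
  have : ∀ i, ∃ n : ℤ, (n : ℚ) = α i * x i := by
    intro i
    obtain ⟨n, hn⟩ := Submodule.mem_one.1 (h (Pi.single i 1))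
    refine ⟨n, ?_⟩
    rw [← diagForm_single (fun i => (α i : ℚ)), ← eq_intCast (algebraMap ℤ ℚ), hn]
    congr 1
    ext j
    by_cases hj : j = i
    · subst hj; simp
    · simp [hj]
  choose η hη using this
  refine ⟨η, ?_⟩
  ext i
  have : (α i : ℚ) ≠ 0 := by exact_mod_cast (hα i).ne_zero
  simp only [dualParam, LinearMap.coe_mk, AddHom.coe_mk, hη]
  field_simp

lemma exists_zsmul_eq_intCast (x : ι → ℚ) :
    ∃ n : ℤ, n ≠ 0 ∧ ∃ z : ι → ℤ, n • x = fun i => (z i : ℚ) := by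
  classical
  refine ⟨∏ i, ((x i).den : ℤ), Finset.prod_ne_zero_iff.2 fun i _ => by
    exact_mod_cast (x i).den_ne_zero,
    fun i => (∏ j ∈ Finset.univ.erase i, ((x j).den : ℤ)) * (x i).num, ?_⟩
  ext i
  rw [Pi.smul_apply, zsmul_eq_mul, ← Finset.prod_erase_mul _ _ (Finset.mem_univ i)]
  push_cast
  rw [mul_assoc, Rat.den_mul_eq_num]

/-- The lattice consists of the dual vectors whose residue at every `p` lies in the chosen
Lagrangian `H p`; it contains the standard lattice. A vector integral against it lies in the dual of
the standard lattice, and testing against lifts from `H p` puts its residue in the orthogonal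
complement of `H p`, which is `H p`. Conversely, products are `p`-integral at each `p` since
residues pair to zero. -/
theorem hasSelfDualLattice_diagForm_of_hasLagrangian (hα : ∀ i, Squarefree (α i))
    (h : ∀ (p : ℕ) [Fact p.Prime], HasLagrangian (residueForm α p)) :
    HasSelfDualLattice (diagForm fun i => (α i : ℚ)) := by
  choose H hH using h
  let M₀ : Submodule ℤ (ι → ℤ) :=
    { carrier := {η | ∀ (p : ℕ) [Fact p.Prime], residueMap α p η ∈ H p}
      add_mem' := fun {x y} hx hy p _ => by rw [map_add]; exact add_mem (hx p) (hy p)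
      zero_mem' := fun p _ => by rw [map_zero]; exact zero_mem _
      smul_mem' := fun c x hx p _ => by rw [map_smul]; exact zsmul_mem (hx p) c }
  have hint : ∀ z : ι → ℤ, (fun i => (z i : ℚ)) ∈ M₀.map (dualParam α) := fun z =>
    ⟨_, fun p _ => by rw [residueMap_mul]; exact zero_mem _, dualParam_mul hα z⟩
  refine ⟨M₀.map (dualParam α), isLattice_of_forall_exists
    ((IsNoetherian.noetherian M₀).map _) fun x => ?_, le_antisymm (fun x hx => ?_) ?_⟩
  · obtain ⟨n, hn, z, hz⟩ := exists_zsmul_eq_intCast x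
    exact ⟨n, hn, hz ▸ hint z⟩
  · obtain ⟨η, rfl⟩ := exists_eq_dualParam hα fun z => hx _ (hint z)
    refine ⟨η, fun p _ => (hH p _).2 fun y hy => ?_, rfl⟩
    have h1 : dualParam α (residueLift α p y) ∈ M₀.map (dualParam α) := by
      refine ⟨_, fun q _ => ?_, rfl⟩
      by_cases hpq : p = q
      · subst hpq
        rw [residueMap_residueLift hα]
        exact hy
      · rw [residueMap_residueLift_of_ne hpq]
        exact zero_mem _
    have h2 := hx _ h1
    rw [(diagForm_isSymm _).eq, diagForm_dualParam_residueLift_mem_one_iff hα] at h2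
    rw [residueForm, (diagForm_isSymm _).eq]
    exact h2
  · rintro _ ⟨η, hη, rfl⟩ _ ⟨η', hη', rfl⟩
    refine mem_one_of_forall_not_dvd fun p _ => ?_
    obtain ⟨N, K, hN, hK, hKr⟩ := exists_mul_diagForm_eq hα p η η'
    rw [(hH p _).1 (hη p) _ (hη' p), mul_zero, ZMod.intCast_zmod_eq_zero_iff_dvd] at hKr
    obtain ⟨K', rfl⟩ := hKr
    refine ⟨N, K', hN, ?_⟩
    have hp : (p : ℚ) ≠ 0 := by exact_mod_cast (Fact.out : p.Prime).ne_zero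
    apply mul_left_cancel₀ hp
    rw [← mul_assoc, hK]
    push_cast
    rfl

/-- The Lagrangian is the set of residues of those vectors of `U` that lie in the dual of the
standard lattice `Λ`. -/
theorem HasSelfDualLattice.hasLagrangian_residueForm (hα : ∀ i, Squarefree (α i))
    (h : HasSelfDualLattice (diagForm fun i => (α i : ℚ))) (p : ℕ) [Fact p.Prime] :
    HasLagrangian (residueForm α p) := by
  obtain ⟨U, hU, hUd⟩ := h
  have hnd : (diagForm fun i => (α i : ℚ)).Nondegenerate :=
    diagForm_nondegenerate fun i => by exact_mod_cast (hα i).ne_zero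
  let Λ : Submodule ℤ (ι → ℚ) := ((LinearMap.pi fun i => (Int.castAddHom ℚ).toIntLinearMap ∘ₗ
    LinearMap.proj i : (ι → ℤ) →ₗ[ℤ] (ι → ℚ))).range
  have hΛ : ∀ z : ι → ℤ, (fun i => (z i : ℚ)) ∈ Λ := fun z => ⟨z, rfl⟩
  have hUΛ : IsLattice ℚ (U ⊔ Λ) := by
    refine IsLattice.of_le_of_isLattice_of_fg ℚ le_sup_left (Submodule.FG.sup hU.fg ?_)
    rw [← Module.Finite.iff_fg]
    infer_instance
  -- Biduality says that the dual of `U ∩ Λ'`, with `Λ'` the dual of `Λ`, is `U + Λ`. Hence the lift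
  -- of a residue orthogonal to the candidate lies in `U + Λ`.
  have hdual := dualSubmodule_dualSubmodule_sup hnd (diagForm_isSymm _) (U ⊔ Λ) ⊥
  rw [Submodule.restrictScalars_bot, sup_bot_eq, dualSubmodule_sup, hUd] at hdual
  refine ⟨{ carrier := {h | ∃ η, dualParam α η ∈ U ∧ residueMap α p η = h}
            add_mem' := ?_
            zero_mem' := ⟨0, by simp, by simp⟩
            smul_mem' := ?_ }, fun x => ⟨?_, fun hx => ?_⟩⟩
  · rintro _ _ ⟨η, hη, rfl⟩ ⟨η', hη', rfl⟩
    exact ⟨η + η', by rw [map_add]; exact add_mem hη hη', map_add _ _ _⟩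
  · rintro c _ ⟨η, hη, rfl⟩
    refine ⟨(c.val : ℤ) • η, by rw [map_zsmul]; exact U.smul_mem _ hη, ?_⟩
    rw [map_zsmul, ← Int.cast_smul_eq_zsmul (ZMod p)]
    simp
  · rintro ⟨η, hη, rfl⟩ _ ⟨η', hη', rfl⟩
    obtain ⟨N, K, hN, hK, hKr⟩ := exists_mul_diagForm_eq hα p η η'
    rw [← hUd] at hη
    obtain ⟨n, hn⟩ := Submodule.mem_one.1 (hη _ hη')
    rw [← hn, eq_intCast] at hK
    have h1 : K = p * N * n := by exact_mod_cast hK.symm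
    rw [h1] at hKr
    push_cast at hKr
    rw [ZMod.natCast_self, zero_mul, zero_mul, eq_comm, mul_eq_zero,
      ZMod.intCast_zmod_eq_zero_iff_dvd] at hKr
    exact hKr.resolve_left hN
  · have h1 : dualParam α (residueLift α p x) ∈ U ⊔ Λ := by
      rw [← hdual]
      rintro y ⟨hyU, hyΛ⟩
      obtain ⟨η, rfl⟩ := exists_eq_dualParam hα fun z => hyΛ _ (hΛ z)
      rw [diagForm_dualParam_residueLift_mem_one_iff hα]
      exact hx _ ⟨η, hyU, rfl⟩
    obtain ⟨u, hu, _, ⟨z, rfl⟩, hz⟩ := Submodule.mem_sup.1 h1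
    -- Removing the component in `Λ` lands in `U` and does not change the residue, since vectors of
    -- `Λ` reduce to zero.
    refine ⟨residueLift α p x - fun i => α i * z i, ?_, ?_⟩
    · rw [map_sub, dualParam_mul hα, ← hz]
      convert hu using 1
      exact add_sub_cancel_right _ _
    · rw [map_sub, residueMap_residueLift hα, residueMap_mul, sub_zero]

end DiagForm

/-! ### Isometries between diagonal forms over a field. -/

section Equivalence

variable {F : Type u} [Field F] {V : Type v} [AddCommGroup V] [Module F V]
  {V' : Type w} [AddCommGroup V'] [Module F V']

lemma HasLagrangian.of_equivalent {b : LinearMap.BilinForm F V} {b' : LinearMap.BilinForm F V'}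
    (hbb : b.Equivalent b') (h : HasLagrangian b) : HasLagrangian b' := by
  obtain ⟨f⟩ := hbb
  obtain ⟨H, hH⟩ := h
  have hf : ∀ x y, b' (f.toLinearEquiv x) (f.toLinearEquiv y) = b x y := f.map_app'
  refine ⟨H.map (f.toLinearEquiv : V →ₗ[F] V'), fun x => ?_⟩
  obtain ⟨x, rfl⟩ := f.toLinearEquiv.surjective x
  rw [← LinearEquiv.coe_coe, Submodule.mem_map_equiv, LinearEquiv.coe_coe,
    LinearEquiv.symm_apply_apply, hH]
  constructor
  · rintro h _ ⟨y, hy, rfl⟩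
    exact (hf x y).trans (h y hy)
  · intro h y hy
    rw [← hf]
    exact h _ ⟨y, hy, rfl⟩

lemma diagForm_equivalent_comp {ι ι' : Type*} [Fintype ι] [Fintype ι'] (σ : ι ≃ ι') (a : ι' → F) :
    (diagForm (a ∘ σ)).Equivalent (diagForm a) :=
  ⟨⟨LinearEquiv.funCongrLeft F F σ.symm, fun x y => by
    change ∑ i, a i * (x (σ.symm i) * y (σ.symm i)) = ∑ i, a (σ i) * (x i * y i)
    rw [← σ.sum_comp]
    simp⟩⟩

lemma diagForm_equivalent_mul_sq {ι : Type*} [Fintype ι] (a c : ι → F) (hc : ∀ i, c i ≠ 0) :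
    (diagForm fun i => a i * c i ^ 2).Equivalent (diagForm a) :=
  ⟨⟨LinearEquiv.piCongrRight fun i => LinearEquiv.smulOfNeZero F F (c i) (hc i), fun x y => by
    change ∑ i, a i * ((c i * x i) * (c i * y i)) = ∑ i, a i * c i ^ 2 * (x i * y i)
    exact Finset.sum_congr rfl fun i _ => by ring⟩⟩

/-- Apply a linear automorphism to the tail of a vector. -/
def consTailEquiv {n : ℕ} (f : (Fin n → F) ≃ₗ[F] (Fin n → F)) :
    (Fin (n + 1) → F) ≃ₗ[F] (Fin (n + 1) → F) where
  toFun x := Fin.cons (x 0) (f (Fin.tail x))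
  invFun x := Fin.cons (x 0) (f.symm (Fin.tail x))
  map_add' x y := by
    ext i; refine Fin.cases ?_ (fun i => ?_) i
    · simp
    · have : Fin.tail (x + y) = Fin.tail x + Fin.tail y := rfl
      simp [this]
  map_smul' c x := by
    ext i; refine Fin.cases ?_ (fun i => ?_) i
    · simp
    · have : Fin.tail (c • x) = c • Fin.tail x := rfl
      simp [this]
  left_inv x := by simp
  right_inv x := by simp

lemma diagForm_cons_equivalent {n : ℕ} {a a' : Fin n → F} (c : F)
    (h : (diagForm a).Equivalent (diagForm a')) :
    (diagForm (Fin.cons c a : Fin (n + 1) → F)).Equivalent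
      (diagForm (Fin.cons c a' : Fin (n + 1) → F)) := by
  obtain ⟨f⟩ := h
  refine ⟨⟨consTailEquiv f.toLinearEquiv, fun x y => ?_⟩⟩
  have hf : diagForm a' (f.toLinearEquiv (Fin.tail x)) (f.toLinearEquiv (Fin.tail y)) =
    diagForm a (Fin.tail x) (Fin.tail y) := f.map_app' _ _
  simp only [diagForm_apply] at hf
  change ∑ i, _ * ((Fin.cons (x 0) (f.toLinearEquiv (Fin.tail x)) : Fin (n + 1) → F) i *
    (Fin.cons (y 0) (f.toLinearEquiv (Fin.tail y)) : Fin (n + 1) → F) i) = ∑ i, _ * (x i * y i)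
  rw [Fin.sum_univ_succ, Fin.sum_univ_succ]
  simp only [Fin.cons_zero, Fin.cons_succ]
  rw [hf]
  rfl

/-- The change of coordinates from `⟨u, v, …⟩` to `⟨u * v, 1, …⟩`, where
`u * s ^ 2 + v * t ^ 2 = 1`. -/
def binaryEquiv {n : ℕ} {u v s t : F} (h : u * s ^ 2 + v * t ^ 2 = 1) :
    (Fin (n + 2) → F) ≃ₗ[F] (Fin (n + 2) → F) where
  toFun x := Fin.cons (-t * x 0 + s * x 1)
    (Fin.cons (u * s * x 0 + v * t * x 1) (Fin.tail (Fin.tail x)))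
  invFun x := Fin.cons (-v * t * x 0 + s * x 1)
    (Fin.cons (u * s * x 0 + t * x 1) (Fin.tail (Fin.tail x)))
  map_add' x y := by
    ext i; refine Fin.cases ?_ (fun i => Fin.cases ?_ (fun i => ?_) i) i
    · simp; ring
    · simp; ring
    · simp [Fin.tail]
  map_smul' c x := by
    ext i; refine Fin.cases ?_ (fun i => Fin.cases ?_ (fun i => ?_) i) i
    · simp; ring
    · simp; ring
    · simp [Fin.tail]
  left_inv x := by
    ext i; refine Fin.cases ?_ (fun i => Fin.cases ?_ (fun i => ?_) i) i
    · simp; linear_combination x 0 * h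
    · simp; linear_combination x 1 * h
    · simp [Fin.tail]
  right_inv x := by
    ext i; refine Fin.cases ?_ (fun i => Fin.cases ?_ (fun i => ?_) i) i
    · simp; linear_combination x 0 * h
    · simp; linear_combination x 1 * h
    · simp [Fin.tail]

/-- A vector of norm `1` splits off; the vector `(-v * t, u * s)` spans its orthogonal complement
and has norm `u * v`. -/
lemma diagForm_binary_equivalent {n : ℕ} {u v s t : F} (h : u * s ^ 2 + v * t ^ 2 = 1)
    (a : Fin n → F) :
    (diagForm (Fin.cons u (Fin.cons v a) : Fin (n + 2) → F)).Equivalent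
      (diagForm (Fin.cons (u * v) (Fin.cons 1 a) : Fin (n + 2) → F)) := by
  refine ⟨⟨binaryEquiv h, fun x y => ?_⟩⟩
  change ∑ i, _ * ((Fin.cons (-t * x 0 + s * x 1) (Fin.cons (u * s * x 0 + v * t * x 1)
      (Fin.tail (Fin.tail x))) : Fin (n + 2) → F) i * (Fin.cons (-t * y 0 + s * y 1)
      (Fin.cons (u * s * y 0 + v * t * y 1) (Fin.tail (Fin.tail y))) : Fin (n + 2) → F) i) =
    ∑ i, _ * (x i * y i)
  rw [Fin.sum_univ_succ, Fin.sum_univ_succ, Fin.sum_univ_succ, Fin.sum_univ_succ]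
  simp only [Fin.cons_zero, Fin.cons_succ, Fin.tail]
  simp only [Fin.succ_zero_eq_one]
  linear_combination (u * x 0 * y 0 + v * x 1 * y 1) * h

end Equivalence

/-! ### Quadratic forms over finite fields: classification and Lagrangians. -/

section FiniteField

variable {F : Type u} [Field F]

lemma exists_mul_sq_add_mul_sq_eq_one [Finite F] (hF : ringChar F ≠ 2) {u v : F} (hu : u ≠ 0)
    (hv : v ≠ 0) : ∃ s t : F, u * s ^ 2 + v * t ^ 2 = 1 := by
  have := Fintype.ofFinite F
  open Polynomial in
  obtain ⟨s, t, hst⟩ := FiniteField.exists_root_sum_quadratic (f := C u * X ^ 2)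
    (g := C v * X ^ 2 - C 1) (degree_C_mul_X_pow 2 hu) (by
      rw [degree_sub_C]
      · exact degree_C_mul_X_pow 2 hv
      · rw [degree_C_mul_X_pow 2 hv]; norm_num) (FiniteField.odd_card_of_char_ne_two hF)
  refine ⟨s, t, ?_⟩
  simp at hst
  linear_combination hst

/-- Over a finite field of odd characteristic every nondegenerate binary form represents `1`, so by
induction rank and determinant determine the form. -/
lemma diagForm_equivalent_cons_one [Finite F] (hF : ringChar F ≠ 2) {n : ℕ} (a : Fin (n + 1) → F)
    (ha : ∀ i, a i ≠ 0) :
    (diagForm a).Equivalent (diagForm (Fin.cons (∏ i, a i) fun _ => 1 : Fin (n + 1) → F)) := by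
  induction n with
  | zero =>
    convert LinearMap.BilinForm.Equivalent.refl (diagForm a)
    ext i
    fin_cases i
    simp
  | succ n ih =>
    have h1 := diagForm_cons_equivalent (a 0) (ih (Fin.tail a) fun i => ha _)
    rw [Fin.cons_self_tail] at h1
    obtain ⟨s, t, hst⟩ := exists_mul_sq_add_mul_sq_eq_one hF (ha 0)
      (Finset.prod_ne_zero_iff.2 fun i _ => ha (Fin.succ i))
    have h2 := h1.trans (diagForm_binary_equivalent hst _)
    have h3 : (Fin.cons 1 fun _ => 1 : Fin (n + 1) → F) = fun _ => 1 := by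
      ext i; refine Fin.cases ?_ (fun i => ?_) i <;> simp
    rw [h3, ← Fin.prod_univ_succ] at h2
    exact h2

lemma hasLagrangian_diagForm_sum (m : ℕ) :
    HasLagrangian (diagForm (Sum.elim (fun _ : Fin m => (1 : F)) fun _ : Fin m => -1)) := by
  refine ⟨{ carrier := {x | ∀ i, x (Sum.inl i) = x (Sum.inr i)}
            add_mem' := fun {x y} hx hy i => by simp [hx i, hy i]
            zero_mem' := fun i => rfl
            smul_mem' := fun c x hx i => by simp [hx i] }, fun x => ⟨fun hx y hy => ?_, fun h => ?_⟩⟩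
  · rw [diagForm_apply, Fintype.sum_sum_type, ← Finset.sum_add_distrib]
    refine Finset.sum_eq_zero fun i _ => ?_
    have h1 : x (Sum.inl i) = x (Sum.inr i) := hx i
    have h2 : y (Sum.inl i) = y (Sum.inr i) := hy i
    simp [h1, h2]
  · intro i
    have h1 := h (Sum.elim (Pi.single i 1) (Pi.single i 1)) fun j => rfl
    rw [diagForm_apply, Fintype.sum_sum_type] at h1
    simpa [Pi.single_apply, ← sub_eq_add_neg, sub_eq_zero] using h1

/-- The form has the rank of a sum of `m` copies of `⟨1, -1⟩`, and the same determinant up to a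
square, so it is isometric to that sum, in which the diagonal subspace is a Lagrangian. -/
lemma hasLagrangian_diagForm [Finite F] (hF : ringChar F ≠ 2) {ι : Type*} [Fintype ι] {a : ι → F}
    (ha : ∀ i, a i ≠ 0) {m : ℕ} (hm : Fintype.card ι = 2 * m)
    (hsq : IsSquare ((-1) ^ m * ∏ i, a i)) : HasLagrangian (diagForm a) := by
  obtain ⟨c, hc⟩ := hsq
  have hc0 : c ≠ 0 := by
    rintro rfl
    simp [Finset.prod_eq_zero_iff, ha] at hc
  -- Rank zero is separate because the normal form needs a first entry to carry the determinant.
  rcases m with - | m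
  · have : IsEmpty ι := Fintype.card_eq_zero_iff.1 hm
    exact ⟨⊤, fun x => ⟨fun _ y _ => by simp [diagForm_apply], fun _ => trivial⟩⟩
  let σ : Fin (2 * m + 1 + 1) ≃ ι := (Fintype.equivFinOfCardEq hm).symm
  let τ : Fin (2 * m + 1 + 1) ≃ Fin (m + 1) ⊕ Fin (m + 1) :=
    (finCongr (by ring)).trans finSumFinEquiv.symm
  let a₁ : Fin (m + 1) ⊕ Fin (m + 1) → F := Sum.elim (fun _ => 1) fun _ => -1
  have ha₁ : ∀ i, a₁ i ≠ 0 := by rintro (i | i) <;> simp [a₁]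
  have h1 := diagForm_equivalent_cons_one hF (a ∘ σ) fun i => ha _
  have h2 := diagForm_equivalent_cons_one hF (a₁ ∘ τ) fun i => ha₁ _
  have h3 : ∏ i, (a ∘ σ) i = ∏ i, a i := σ.prod_comp a
  have h4 : ∏ i, (a₁ ∘ τ) i = (-1) ^ (m + 1) := by
    rw [show ∏ i, (a₁ ∘ τ) i = ∏ i, a₁ i from τ.prod_comp a₁, Fintype.prod_sum_type]
    simp [a₁]
  have h5 := diagForm_equivalent_mul_sq (Fin.cons ((-1) ^ (m + 1)) fun _ => 1)
    (Fin.cons c fun _ => 1 : Fin (2 * m + 1 + 1) → F) (by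
      intro i; refine Fin.cases ?_ (fun i => ?_) i <;> simp [hc0])
  have h6 : (fun i => (Fin.cons ((-1) ^ (m + 1)) fun _ => 1 : Fin (2 * m + 1 + 1) → F) i *
      (Fin.cons c fun _ => 1 : Fin (2 * m + 1 + 1) → F) i ^ 2) =
      Fin.cons (∏ i, a i) fun _ => 1 := by
    ext i; refine Fin.cases ?_ (fun i => ?_) i
    · simp only [Fin.cons_zero]
      rw [sq, ← hc, ← mul_assoc, ← mul_pow]
      simp
    · simp
  rw [h3] at h1
  rw [h4] at h2
  rw [h6] at h5
  exact (hasLagrangian_diagForm_sum (m + 1)).of_equivalent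
    ((((diagForm_equivalent_comp τ a₁).symm.trans h2).trans h5.symm).trans
      (h1.symm.trans (diagForm_equivalent_comp σ a)))

lemma det_fromBlocks_zero₁₁ {R : Type*} [CommRing R] {m : ℕ} (B C D : Matrix (Fin m) (Fin m) R) :
    (Matrix.fromBlocks 0 B C D).det = (-1) ^ m * (B.det * C.det) := by
  have h1 : Matrix.fromBlocks 0 B C D =
      Matrix.fromBlocks B 0 D C * Matrix.fromBlocks 0 1 1 0 := by
    simp [Matrix.fromBlocks_multiply]
  -- This factorization serves to evaluate the determinant of the block swap as `(-1) ^ m`.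
  have h2 : (Matrix.fromBlocks (0 : Matrix (Fin m) (Fin m) R) 1 1 0 : Matrix _ _ R) *
      (Matrix.fromBlocks 1 0 1 1 : Matrix (Fin m ⊕ Fin m) (Fin m ⊕ Fin m) R) =
      Matrix.fromBlocks 1 1 1 0 := by
    simp [Matrix.fromBlocks_multiply]
  have h3 := congrArg Matrix.det h2
  rw [Matrix.det_mul, Matrix.det_fromBlocks_zero₁₂, Matrix.det_fromBlocks_one₁₁] at h3
  simp [Matrix.det_neg] at h3
  rw [h1, Matrix.det_mul, Matrix.det_fromBlocks_zero₁₂, h3, mul_comm]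

lemma toMatrix_basisFun_diagForm {ι : Type*} [Fintype ι] [DecidableEq ι] (a : ι → F) :
    LinearMap.BilinForm.toMatrix (Pi.basisFun F ι) (diagForm a) = Matrix.diagonal a := by
  ext i j
  rw [LinearMap.BilinForm.toMatrix_apply, Pi.basisFun_apply, Pi.basisFun_apply, diagForm_single,
    Matrix.diagonal_apply, Pi.single_apply]
  by_cases hij : i = j
  · simp [hij]
  · simp [hij, Ne.symm hij]

/-- In a basis adapted to a Lagrangian and a complement, the Gram matrix has a zero block, so its
determinant is `(-1) ^ m` times the square of the determinant of the off-diagonal block. -/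
lemma HasLagrangian.isSquare {ι : Type*} [Fintype ι] {a : ι → F} (ha : ∀ i, a i ≠ 0)
    (h : HasLagrangian (diagForm a)) :
    ∃ m, Fintype.card ι = 2 * m ∧ IsSquare ((-1) ^ m * ∏ i, a i) := by
  classical
  obtain ⟨H, hH⟩ := h
  have hnd := diagForm_nondegenerate ha
  have hs := diagForm_isSymm a
  have hHo : (diagForm a).orthogonal H = H := by
    ext x
    rw [LinearMap.BilinForm.mem_orthogonal_iff, hH x]
    exact forall₂_congr fun y _ => by rw [hs.eq x y]
  have h1 := LinearMap.BilinForm.finrank_orthogonal hnd H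
  have hle := Submodule.finrank_le H
  rw [hHo, Module.finrank_fintype_fun_eq_card] at h1
  rw [Module.finrank_fintype_fun_eq_card] at hle
  obtain ⟨H', hH'⟩ := H.exists_isCompl
  have h2 := Submodule.finrank_add_eq_of_isCompl hH'
  rw [Module.finrank_fintype_fun_eq_card] at h2
  let e₁ := Module.finBasis F H
  let e₂ := (Module.finBasis F H').reindex (finCongr (by omega : finrank F H' = finrank F H))
  let e := (e₁.prod e₂).map (Submodule.prodEquivOfIsCompl H H' hH')
  let σ : Fin (finrank F H) ⊕ Fin (finrank F H) ≃ ι := Fintype.equivOfCardEq (by simp; omega)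
  refine ⟨finrank F H, by omega, ?_⟩
  have h3 : LinearMap.BilinForm.toMatrix e (diagForm a) = Matrix.fromBlocks 0
      (Matrix.of fun i j => diagForm a (e₁ i) (e₂ j))
      (Matrix.of fun i j => diagForm a (e₁ i) (e₂ j)).transpose
      (Matrix.of fun i j => diagForm a (e₂ i) (e₂ j)) := by
    ext (i | i) (j | j)
    · simpa [LinearMap.BilinForm.toMatrix_apply, e] using
        (hH _).1 (e₁ i).2 _ (e₁ j).2
    · simp [LinearMap.BilinForm.toMatrix_apply, e]
    · simpa [LinearMap.BilinForm.toMatrix_apply, e] using hs.eq _ _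
    · simp [LinearMap.BilinForm.toMatrix_apply, e]
  have h4 := congrArg Matrix.det h3
  rw [det_fromBlocks_zero₁₁, Matrix.det_transpose] at h4
  have h6 := congrArg Matrix.det (LinearMap.BilinForm.toMatrix_mul_basis_toMatrix (B := diagForm a)
    (Pi.basisFun F ι) (e.reindex σ))
  have h7 : LinearMap.BilinForm.toMatrix (e.reindex σ) (diagForm a) =
      (LinearMap.BilinForm.toMatrix e (diagForm a)).submatrix σ.symm σ.symm := by
    ext i j
    simp [LinearMap.BilinForm.toMatrix_apply]
  rw [h7, Matrix.det_submatrix_equiv_self, h4, Matrix.det_mul, Matrix.det_mul,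
    Matrix.det_transpose, toMatrix_basisFun_diagForm, Matrix.det_diagonal] at h6
  set δ := ((Pi.basisFun F ι).toMatrix (e.reindex σ)).det with hδ
  have hδ0 : δ ≠ 0 := by
    intro h0
    have := congrArg Matrix.det ((Pi.basisFun F ι).toMatrix_mul_toMatrix_flip (e.reindex σ))
    rw [Matrix.det_mul, ← hδ, h0] at this
    simp at this
  set β := (Matrix.of fun i j => diagForm a (e₁ i) (e₂ j)).det
  refine ⟨β / δ, ?_⟩
  have h8 : ∏ i, a i = (-1) ^ finrank F H * (β * β) / (δ * δ) := by
    rw [← h6]; field_simp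
  rw [h8]
  have h9 : ((-1 : F) ^ finrank F H) * (-1) ^ finrank F H = 1 := by
    rw [← mul_pow]; simp
  field_simp
  linear_combination β ^ 2 * h9

end FiniteField

end RatPDA

namespace RatPDA

universe u v w

open Module

/-! ### The Hilbert symbol at odd primes and the tame formula. -/

section Hilbert

variable {p : ℕ} [hp : Fact p.Prime]

lemma toZMod_ne_zero_iff (x : ℤ_[p]) : PadicInt.toZMod x ≠ 0 ↔ ‖x‖ = 1 := by
  rw [← PadicInt.isUnit_iff, ← not_iff_not, not_not, ← RingHom.mem_ker, PadicInt.ker_toZMod,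
    IsLocalRing.mem_maximalIdeal, mem_nonunits_iff]

lemma toZMod_eq_zero_iff_dvd (x : ℤ_[p]) : PadicInt.toZMod x = 0 ↔ (p : ℤ_[p]) ∣ x := by
  rw [← RingHom.mem_ker, PadicInt.ker_toZMod, IsLocalRing.mem_maximalIdeal, mem_nonunits_iff,
    PadicInt.not_isUnit_iff, PadicInt.norm_lt_one_iff_dvd]

lemma two_ne_zero_zmod (hodd : Odd p) : (2 : ZMod p) ≠ 0 := by
  have h := (ZMod.natCast_eq_zero_iff 2 p).not.2 (fun h => by
    have := (Nat.prime_dvd_prime_iff_eq hp.out Nat.prime_two).1 h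
    subst this
    exact absurd hodd (by decide))
  exact_mod_cast h

lemma ringChar_zmod_ne_two (hodd : Odd p) : ringChar (ZMod p) ≠ 2 := by
  rw [ZMod.ringChar_zmod_n]
  rintro rfl
  exact absurd hodd (by decide)

/-- Hensel's lemma for `X ^ 2 - u`: the derivative `2 * a` at an approximate root is a unit because
`p` is odd. -/
lemma isSquare_of_isSquare_toZMod (hodd : Odd p) {u : ℤ_[p]} (hu : PadicInt.toZMod u ≠ 0)
    (h : IsSquare (PadicInt.toZMod u)) : IsSquare u := by
  obtain ⟨r, hr⟩ := h
  obtain ⟨a, rfl⟩ := ZMod.ringHom_surjective (PadicInt.toZMod (p := p)) r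
  have ha : PadicInt.toZMod a ≠ 0 := by
    intro h0
    rw [h0, mul_zero] at hr
    exact hu hr
  let F : Polynomial ℤ_[p] := Polynomial.X ^ 2 - Polynomial.C u
  have h1 : F.aeval a = a ^ 2 - u := by simp [F]
  have h2 : F.derivative.aeval a = 2 * a := by simp [F, one_add_one_eq_two]
  have h3 : ‖F.derivative.aeval a‖ = 1 := by
    rw [h2, ← toZMod_ne_zero_iff, map_mul]
    exact mul_ne_zero (by rw [map_ofNat]; exact two_ne_zero_zmod hodd) ha
  have h4 : ‖F.aeval a‖ < ‖F.derivative.aeval a‖ ^ 2 := by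
    rw [h3, one_pow, h1, ← PadicInt.not_isUnit_iff, PadicInt.isUnit_iff, ← toZMod_ne_zero_iff,
      not_not, map_sub, map_pow, hr, sq, sub_self]
  obtain ⟨z, hz, -⟩ := hensels_lemma h4
  refine ⟨z, ?_⟩
  have : z ^ 2 - u = 0 := by simpa [F] using hz
  rw [← sq]
  exact (sub_eq_zero.1 this).symm

/-- The equation `z² = a x² + b y²` has a nonzero solution. -/
def HilbertSolvable {K : Type*} [Field K] (a b : K) : Prop :=
  ∃ x y z : K, (x, y, z) ≠ (0, 0, 0) ∧ z ^ 2 = a * x ^ 2 + b * y ^ 2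

lemma HilbertSolvable.symm {K : Type*} [Field K] {a b : K} (h : HilbertSolvable a b) :
    HilbertSolvable b a := by
  obtain ⟨x, y, z, h0, h⟩ := h
  refine ⟨y, x, z, fun h1 => h0 ?_, by rw [h]; ring⟩
  simp only [Prod.mk.injEq] at h1 ⊢
  tauto

lemma HilbertSolvable.mul_sq {K : Type*} [Field K] {a b c : K} (hc : c ≠ 0)
    (h : HilbertSolvable a b) : HilbertSolvable (a * c ^ 2) b := by
  obtain ⟨x, y, z, h0, h⟩ := h
  refine ⟨x / c, y, z, fun h1 => h0 ?_, by rw [h]; field_simp⟩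
  simp only [Prod.mk.injEq, div_eq_zero_iff, hc, or_false] at h1 ⊢
  exact h1

/-- Multiplying the equation by `a` gives `(a x)² = a z² - a b y²`. -/
lemma HilbertSolvable.neg_mul {K : Type*} [Field K] {a b : K} (ha : a ≠ 0)
    (h : HilbertSolvable a b) : HilbertSolvable a (-(a * b)) := by
  obtain ⟨x, y, z, h0, h⟩ := h
  refine ⟨z, y, a * x, fun h1 => h0 ?_, by rw [h]; ring⟩
  simp only [Prod.mk.injEq, mul_eq_zero, ha, false_or] at h1 ⊢
  tauto

lemma hilbertSolvable_of_units (hodd : Odd p) {u v : ℤ_[p]} (hu : PadicInt.toZMod u ≠ 0)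
    (hv : PadicInt.toZMod v ≠ 0) : HilbertSolvable (u : ℚ_[p]) v := by
  obtain ⟨s, t, hst⟩ := exists_mul_sq_add_mul_sq_eq_one (ringChar_zmod_ne_two hodd) hu hv
  obtain ⟨s, rfl⟩ := ZMod.ringHom_surjective (PadicInt.toZMod (p := p)) s
  obtain ⟨t, rfl⟩ := ZMod.ringHom_surjective (PadicInt.toZMod (p := p)) t
  have h1 : PadicInt.toZMod (u * s ^ 2 + v * t ^ 2) = 1 := by simpa using hst
  obtain ⟨z, hz⟩ := isSquare_of_isSquare_toZMod hodd (by rw [h1]; exact one_ne_zero)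
    (by rw [h1]; exact IsSquare.one)
  refine ⟨s, t, z, fun h0 => ?_, ?_⟩
  · simp only [Prod.mk.injEq, PadicInt.coe_eq_zero] at h0
    rw [hz, h0.2.2] at h1
    simp at h1
  · have h2 := congrArg ((↑) : ℤ_[p] → ℚ_[p]) hz
    push_cast at h2
    rw [h2, sq]

lemma exists_primitive {ι : Type*} [Finite ι] (f : ι → ℚ_[p]) (hf : f ≠ 0) :
    ∃ (c : ℚ_[p]) (g : ι → ℤ_[p]), c ≠ 0 ∧ (∀ i, f i = c * g i) ∧
      ∃ i, PadicInt.toZMod (g i) ≠ 0 := by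
  obtain ⟨j, hj⟩ := Function.ne_iff.1 hf
  have : Nonempty ι := ⟨j⟩
  obtain ⟨i, hi⟩ := Finite.exists_max fun i => ‖f i‖
  have hi0 : f i ≠ 0 := by
    intro h0
    have := hi j
    rw [h0, norm_zero] at this
    exact hj (norm_le_zero_iff.1 this)
  refine ⟨f i, fun k => ⟨f k / f i, ?_⟩, hi0, fun k => ?_, i, ?_⟩
  · rw [norm_div]
    exact div_le_one_of_le₀ (hi k) (norm_nonneg _)
  · field_simp
  · refine (toZMod_ne_zero_iff _).2 ?_
    change ‖f i / f i‖ = 1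
    simp [hi0]

/-- Reducing a primitive solution modulo `p` gives `z² = u x²` with `x` nonzero; in the other
direction a residue square lifts to a square. -/
lemma hilbertSolvable_unit_prime_iff (hodd : Odd p) {u v : ℤ_[p]} (hu : PadicInt.toZMod u ≠ 0)
    (hv : PadicInt.toZMod v ≠ 0) :
    HilbertSolvable (u : ℚ_[p]) (p * v : ℚ_[p]) ↔ IsSquare (PadicInt.toZMod u) := by
  constructor
  · rintro ⟨x, y, z, h0, h⟩
    obtain ⟨c, g, hc, hg, hi⟩ := exists_primitive ![x, y, z] (fun h1 => h0 (by
      simpa [funext_iff, Fin.forall_fin_succ] using h1))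
    have hx : x = c * g 0 := hg 0
    have hy : y = c * g 1 := hg 1
    have hz : z = c * g 2 := hg 2
    have h1 : (g 2) ^ 2 = u * (g 0) ^ 2 + p * v * (g 1) ^ 2 := by
      have : ((g 2 : ℚ_[p])) ^ 2 = u * (g 0 : ℚ_[p]) ^ 2 + p * v * (g 1 : ℚ_[p]) ^ 2 := by
        apply mul_left_cancel₀ (pow_ne_zero 2 hc)
        rw [hx, hy, hz] at h
        linear_combination h
      apply PadicInt.ext
      push_cast
      exact this
    have h2 := congrArg PadicInt.toZMod h1
    simp only [map_add, map_mul, map_pow, map_natCast, CharP.cast_eq_zero, zero_mul,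
      add_zero] at h2
    by_cases hx0 : PadicInt.toZMod (g 0) = 0
    · exfalso
      have hz0 : PadicInt.toZMod (g 2) = 0 := by
        rw [hx0] at h2
        simpa using h2
      -- If `p` divides `x` and `z`, then `p²` divides `p v y²`, so `p` divides `y` as well,
      -- contradicting primitivity.
      have hy0 : PadicInt.toZMod (g 1) = 0 := by
        rw [toZMod_eq_zero_iff_dvd] at hx0 hz0
        obtain ⟨x', hx'⟩ := hx0
        obtain ⟨z', hz'⟩ := hz0
        have hp0 : (p : ℤ_[p]) ≠ 0 := by exact_mod_cast hp.out.ne_zero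
        have h3 : v * (g 1) ^ 2 = p * (z' ^ 2 - u * x' ^ 2) := by
          apply mul_left_cancel₀ hp0
          rw [hx', hz'] at h1
          linear_combination -h1
        have h4 := congrArg PadicInt.toZMod h3
        simp only [map_mul, map_pow, map_natCast, CharP.cast_eq_zero, zero_mul] at h4
        simpa [hv] using h4
      obtain ⟨i, hi⟩ := hi
      fin_cases i
      · exact hi hx0
      · exact hi hy0
      · exact hi hz0
    · refine ⟨PadicInt.toZMod (g 2) / PadicInt.toZMod (g 0), ?_⟩
      field_simp
      exact h2.symm
  · intro h
    obtain ⟨c, hc⟩ := isSquare_of_isSquare_toZMod hodd hu h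
    refine ⟨1, 0, c, by simp, ?_⟩
    rw [hc]
    push_cast
    ring

/-- The unit part `x / p ^ v(x)` of a `p`-adic number. -/
noncomputable def unitPart (x : ℚ_[p]) : ℤ_[p] :=
  ⟨x * (p : ℚ_[p]) ^ (-x.valuation), by
    by_cases hx : x = 0
    · simp [hx]
    · have hp0 : (p : ℝ) ≠ 0 := by exact_mod_cast hp.out.ne_zero
      rw [norm_mul, Padic.norm_p_zpow, Padic.norm_eq_zpow_neg_valuation hx, neg_neg,
        ← zpow_add₀ hp0]
      simp⟩

lemma unitPart_mul {x y : ℚ_[p]} (hx : x ≠ 0) (hy : y ≠ 0) :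
    unitPart (x * y) = unitPart x * unitPart y := by
  apply PadicInt.ext
  have hp0 : (p : ℚ_[p]) ≠ 0 := by exact_mod_cast hp.out.ne_zero
  change x * y * (p : ℚ_[p]) ^ (-(x * y).valuation) =
    x * (p : ℚ_[p]) ^ (-x.valuation) * (y * (p : ℚ_[p]) ^ (-y.valuation))
  rw [Padic.valuation_mul hx hy, neg_add, zpow_add₀ hp0]
  ring

lemma unitPart_one : unitPart (1 : ℚ_[p]) = 1 := by
  apply PadicInt.ext
  simp [unitPart]

lemma toZMod_unitPart_ne_zero {x : ℚ_[p]} (hx : x ≠ 0) : PadicInt.toZMod (unitPart x) ≠ 0 := by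
  have h1 : unitPart x * unitPart x⁻¹ = 1 := by
    rw [← unitPart_mul hx (inv_ne_zero hx), mul_inv_cancel₀ hx, unitPart_one]
  have h2 := congrArg PadicInt.toZMod h1
  rw [map_mul, map_one] at h2
  exact left_ne_zero_of_mul_eq_one h2

lemma coe_unitPart (x : ℚ_[p]) : (unitPart x : ℚ_[p]) = x * (p : ℚ_[p]) ^ (-x.valuation) := rfl

/-- The quadratic character of the residue of the unit part. -/
noncomputable def unitChar : ℚ_[p]ˣ →* ℤˣ where
  toFun x := (quadraticChar (ZMod p)).toUnitHom
    (Units.mk0 (PadicInt.toZMod (unitPart (x : ℚ_[p]))) (toZMod_unitPart_ne_zero x.ne_zero))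
  map_one' := by
    rw [← map_one (quadraticChar (ZMod p)).toUnitHom]
    congr 1
    ext
    simp [unitPart_one]
  map_mul' x y := by
    rw [← map_mul]
    congr 1
    ext
    simp [unitPart_mul]

lemma coe_unitChar (x : ℚ_[p]ˣ) :
    (unitChar x : ℤ) = quadraticChar (ZMod p) (PadicInt.toZMod (unitPart (x : ℚ_[p]))) := rfl

lemma unitChar_eq_one_iff (x : ℚ_[p]ˣ) :
    unitChar x = 1 ↔ IsSquare (PadicInt.toZMod (unitPart (x : ℚ_[p]))) := by
  rw [← quadraticChar_one_iff_isSquare (toZMod_unitPart_ne_zero x.ne_zero), ← coe_unitChar,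
    Units.val_eq_one]

lemma intUnits_sq (x : ℤˣ) : x ^ 2 = 1 := Int.units_sq x

lemma intUnits_zpow_of_even (x : ℤˣ) {n : ℤ} (hn : Even n) : x ^ n = 1 := by
  obtain ⟨k, rfl⟩ := hn
  rw [← two_mul, zpow_mul]
  simp

/-- The tame symbol formula for the Hilbert symbol at odd primes. -/
noncomputable def tameSymbol (a b : ℚ_[p]ˣ) : ℤˣ :=
  unitChar (-1 : ℚ_[p]ˣ) ^ ((a : ℚ_[p]).valuation * (b : ℚ_[p]).valuation) *
    unitChar a ^ (b : ℚ_[p]).valuation * unitChar b ^ (a : ℚ_[p]).valuation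

lemma tameSymbol_comm (a b : ℚ_[p]ˣ) : tameSymbol a b = tameSymbol b a := by
  rw [tameSymbol, tameSymbol, mul_comm (a : ℚ_[p]).valuation, mul_right_comm]

lemma tameSymbol_mul_left (a a' b : ℚ_[p]ˣ) :
    tameSymbol (a * a') b = tameSymbol a b * tameSymbol a' b := by
  simp only [tameSymbol, Units.val_mul, Padic.valuation_mul a.ne_zero a'.ne_zero, add_mul,
    zpow_add, map_mul, mul_zpow]
  exact by ac_rfl

lemma tameSymbol_mul_right (a b b' : ℚ_[p]ˣ) :
    tameSymbol a (b * b') = tameSymbol a b * tameSymbol a b' := by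
  rw [tameSymbol_comm, tameSymbol_mul_left, tameSymbol_comm b, tameSymbol_comm b']

lemma tameSymbol_sq_left (c b : ℚ_[p]ˣ) : tameSymbol (c ^ 2) b = 1 := by
  rw [sq, tameSymbol_mul_left, ← sq, intUnits_sq]

lemma padicValuation_neg_one : (-1 : ℚ_[p]).valuation = 0 := by
  have h := Padic.valuation_mul (p := p) (x := -1) (y := -1) (by simp) (by simp)
  simp at h
  omega

lemma tameSymbol_self (a : ℚ_[p]ˣ) : tameSymbol a a = tameSymbol a (-1) := by
  simp only [tameSymbol, Units.val_neg, Units.val_one, padicValuation_neg_one, mul_zero, zpow_zero,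
    one_mul]
  rw [mul_assoc, ← sq (unitChar a ^ _), intUnits_sq, mul_one]
  rcases Int.even_or_odd (a : ℚ_[p]).valuation with h | h
  · rw [intUnits_zpow_of_even _ h, intUnits_zpow_of_even _ (h.mul_left _)]
  · obtain ⟨k, hk⟩ := h
    rw [zpow_mul, hk, zpow_add, zpow_mul]
    simp

lemma tameSymbol_neg_mul (a b : ℚ_[p]ˣ) : tameSymbol a (-(a * b)) = tameSymbol a b := by
  rw [← neg_one_mul, tameSymbol_mul_right, tameSymbol_mul_right, ← tameSymbol_self, ← mul_assoc,
    ← sq, intUnits_sq, one_mul]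

lemma unitPart_of_valuation_eq_zero {x : ℚ_[p]} (h : x.valuation = 0) :
    (unitPart x : ℚ_[p]) = x := by
  rw [coe_unitPart, h]; simp

lemma hilbertSolvable_iff_of_valuation_eq_zero (hodd : Odd p) {a b : ℚ_[p]ˣ}
    (ha : (a : ℚ_[p]).valuation = 0) (hb : (b : ℚ_[p]).valuation = 0 ∨ (b : ℚ_[p]).valuation = 1) :
    HilbertSolvable (a : ℚ_[p]) b ↔ tameSymbol a b = 1 := by
  have hp0 : (p : ℚ_[p]) ≠ 0 := by exact_mod_cast hp.out.ne_zero
  have h1 := toZMod_unitPart_ne_zero a.ne_zero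
  have h2 := toZMod_unitPart_ne_zero b.ne_zero
  rcases hb with hb | hb
  · have := hilbertSolvable_of_units hodd h1 h2
    rw [unitPart_of_valuation_eq_zero ha, unitPart_of_valuation_eq_zero hb] at this
    simp [this, tameSymbol, ha, hb]
  · have := hilbertSolvable_unit_prime_iff hodd h1 h2
    rw [unitPart_of_valuation_eq_zero ha, coe_unitPart (b : ℚ_[p]), hb, mul_left_comm,
      ← zpow_one_add₀ hp0] at this
    simp only [Int.reduceNeg, add_neg_cancel, zpow_zero, mul_one] at this
    rw [this, ← unitChar_eq_one_iff]
    simp [tameSymbol, ha, hb]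

lemma exists_mul_sq_valuation (a : ℚ_[p]ˣ) : ∃ c a' : ℚ_[p]ˣ, a = a' * c ^ 2 ∧
    ((a' : ℚ_[p]).valuation = 0 ∨ (a' : ℚ_[p]).valuation = 1) := by
  have hp0 : (p : ℚ_[p]) ≠ 0 := by exact_mod_cast hp.out.ne_zero
  -- Removing an even power of `p` leaves the valuation modulo `2`; integer division rounds down, so
  -- the remainder is `0` or `1` also for negative valuations.
  let c : ℚ_[p]ˣ := Units.mk0 (p : ℚ_[p]) hp0 ^ ((a : ℚ_[p]).valuation / 2)
  refine ⟨c, a * (c ^ 2)⁻¹, by simp, ?_⟩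
  have h : ((a * (c ^ 2)⁻¹ : ℚ_[p]ˣ) : ℚ_[p]).valuation = (a : ℚ_[p]).valuation % 2 := by
    rw [Units.val_mul, Padic.valuation_mul a.ne_zero (Units.ne_zero _)]
    simp [c, Padic.valuation_inv, Padic.valuation_pow, Padic.valuation_zpow]
    omega
  rw [h]
  omega

lemma hilbertSolvable_mul_sq_left_iff {K : Type*} [Field K] (a b : K) {c : K} (hc : c ≠ 0) :
    HilbertSolvable (a * c ^ 2) b ↔ HilbertSolvable a b := by
  refine ⟨fun h => ?_, fun h => h.mul_sq hc⟩
  have := h.mul_sq (inv_ne_zero hc)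
  rwa [mul_assoc, ← mul_pow, mul_inv_cancel₀ hc, one_pow, mul_one] at this

lemma hilbertSolvable_comm {K : Type*} [Field K] (a b : K) :
    HilbertSolvable a b ↔ HilbertSolvable b a :=
  ⟨HilbertSolvable.symm, HilbertSolvable.symm⟩

lemma hilbertSolvable_neg_mul_iff {K : Type*} [Field K] {a : K} (b : K) (ha : a ≠ 0) :
    HilbertSolvable a (-(a * b)) ↔ HilbertSolvable a b := by
  refine ⟨fun h => ?_, HilbertSolvable.neg_mul ha⟩
  have h1 := (h.neg_mul ha).symm
  rw [show -(a * -(a * b)) = b * a ^ 2 by ring, hilbertSolvable_mul_sq_left_iff _ _ ha] at h1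
  exact h1.symm

/-- Both sides are symmetric, invariant under squares, and unchanged when `b` is replaced by `-(a *
b)`. Squares reduce the valuations to `0` or `1`, and the last replacement turns two valuations
equal to `1` into a case with a unit entry. -/
theorem hilbertSolvable_iff_tameSymbol (hodd : Odd p) (a b : ℚ_[p]ˣ) :
    HilbertSolvable (a : ℚ_[p]) b ↔ tameSymbol a b = 1 := by
  have hred : ∀ a b c : ℚ_[p]ˣ, (HilbertSolvable (a : ℚ_[p]) b ↔ tameSymbol a b = 1) →
      (HilbertSolvable ((a * c ^ 2 : ℚ_[p]ˣ) : ℚ_[p]) b ↔ tameSymbol (a * c ^ 2) b = 1) := by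
    intro a b c h
    rw [Units.val_mul, Units.val_pow_eq_pow_val, hilbertSolvable_mul_sq_left_iff _ _ c.ne_zero,
      tameSymbol_mul_left, tameSymbol_sq_left, mul_one, h]
  have hcomm : ∀ a b : ℚ_[p]ˣ, (HilbertSolvable (a : ℚ_[p]) b ↔ tameSymbol a b = 1) →
      (HilbertSolvable (b : ℚ_[p]) a ↔ tameSymbol b a = 1) := by
    intro a b h
    rw [hilbertSolvable_comm, tameSymbol_comm, h]
  have hunit : ∀ a b : ℚ_[p]ˣ, (a : ℚ_[p]).valuation = 0 →
      (HilbertSolvable (a : ℚ_[p]) b ↔ tameSymbol a b = 1) := by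
    intro a b ha
    obtain ⟨c, b, rfl, hb⟩ := exists_mul_sq_valuation b
    exact hcomm _ _ (hred _ _ _ (hcomm _ _ (hilbertSolvable_iff_of_valuation_eq_zero hodd ha hb)))
  obtain ⟨c, a, rfl, ha⟩ := exists_mul_sq_valuation a
  refine hred _ _ _ ?_
  obtain ⟨d, b, rfl, hb⟩ := exists_mul_sq_valuation b
  refine hcomm _ _ (hred _ _ _ ?_)
  rcases ha with ha | ha
  · exact hcomm _ _ (hunit _ _ ha)
  rcases hb with hb | hb
  · exact hunit _ _ hb
  rw [← hilbertSolvable_neg_mul_iff _ b.ne_zero, ← tameSymbol_neg_mul,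
    ← Units.val_mul, ← Units.val_neg]
  -- The product has valuation `2`, so parity forces its reduced representative `f` to be a unit.
  obtain ⟨e, f, hef, hf⟩ := exists_mul_sq_valuation (-(b * a))
  have hv : ((-(b * a) : ℚ_[p]ˣ) : ℚ_[p]).valuation = 2 := by
    rw [← neg_one_mul, Units.val_mul, Padic.valuation_mul (by simp) (by simp), Units.val_mul,
      Padic.valuation_mul (by simp) (by simp), ha, hb]
    simp [padicValuation_neg_one]
  have hv' := hv
  rw [hef, Units.val_mul, Padic.valuation_mul (by simp) (by simp), Units.val_pow_eq_pow_val,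
    Padic.valuation_pow] at hv'
  push_cast at hv'
  rw [hef]
  exact hcomm _ _ (hred _ _ _ (hunit _ _ (by omega)))

end Hilbert

/-! ### Products of tame symbols over pairs of indices. -/

section PairProduct

/-- The product of `T (a i) (a j)` over all `i < j`. -/
def pairProd {A B : Type*} [CommMonoid B] (T : A → A → B) {n : ℕ} (a : Fin n → A) : B :=
  ∏ i : Fin n, ∏ j ∈ Finset.Ioi i, T (a i) (a j)

lemma pairProd_succ {A B : Type*} [CommMonoid B] (T : A → A → B) {n : ℕ} (a : Fin (n + 1) → A) :
    pairProd T a = (∏ j, T (a 0) (a (Fin.succ j))) * pairProd T (fun i => a (Fin.succ i)) := by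
  rw [pairProd, Fin.prod_univ_succ, Fin.prod_Ioi_zero fun j => T (a 0) (a j)]
  congr 1
  exact Finset.prod_congr rfl fun i _ => Fin.prod_Ioi_succ (fun j => T (a (Fin.succ i)) (a j)) i

variable {p : ℕ} [hp : Fact p.Prime]

lemma tameSymbol_one_right (a : ℚ_[p]ˣ) : tameSymbol a 1 = 1 := by
  simp [tameSymbol]

lemma tameSymbol_prod_right {ι : Type*} (s : Finset ι) (a : ℚ_[p]ˣ) (f : ι → ℚ_[p]ˣ) :
    tameSymbol a (∏ i ∈ s, f i) = ∏ i ∈ s, tameSymbol a (f i) := by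
  classical
  induction s using Finset.induction_on with
  | empty => simp [tameSymbol_one_right]
  | insert i s hi ih => rw [Finset.prod_insert hi, Finset.prod_insert hi, tameSymbol_mul_right, ih]

/-- By bilinearity each pair contributes one `(c, c)`, and each `(c, a i)` occurs in `n - 1` pairs.
The extra factor on the left raises that exponent to `n` and avoids truncated subtraction. -/
lemma pairProd_tameSymbol_mul {n : ℕ} (c : ℚ_[p]ˣ) (a : Fin n → ℚ_[p]ˣ) :
    pairProd tameSymbol (fun i => c * a i) * tameSymbol c (∏ i, a i) =
      tameSymbol c c ^ n.choose 2 * tameSymbol c (∏ i, a i) ^ n * pairProd tameSymbol a := by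
  induction n with
  | zero => simp [pairProd, tameSymbol_one_right]
  | succ n ih =>
    have ih := ih fun i => a (Fin.succ i)
    rw [pairProd_succ, pairProd_succ tameSymbol a, ← tameSymbol_prod_right, ← tameSymbol_prod_right,
      Finset.prod_mul_distrib, Finset.prod_const, Finset.card_fin, Fin.prod_univ_succ,
      tameSymbol_mul_left, tameSymbol_mul_right, tameSymbol_mul_right, tameSymbol_mul_right,
      Nat.choose_succ_succ' n 1, Nat.choose_one_right]
    have hpow : ∀ x : ℚ_[p]ˣ, tameSymbol x (c ^ n) = tameSymbol x c ^ n := fun x => by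
      have := tameSymbol_prod_right (Finset.univ : Finset (Fin n)) x fun _ => c
      simpa using this
    rw [hpow, hpow, tameSymbol_comm (a 0) c]
    set P := ∏ i : Fin n, a (Fin.succ i)
    calc _ = tameSymbol c c ^ n * tameSymbol c (a 0) ^ (n + 1) * tameSymbol c P *
            tameSymbol (a 0) P *
            (pairProd tameSymbol (fun i : Fin n => c * a (Fin.succ i)) * tameSymbol c P) := by
          apply Units.ext
          push_cast
          ring
      _ = _ := by
          rw [ih]
          apply Units.ext
          push_cast
          ring

lemma valuation_prod {ι : Type*} (s : Finset ι) (f : ι → ℚ_[p]ˣ) :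
    ((∏ i ∈ s, f i : ℚ_[p]ˣ) : ℚ_[p]).valuation = ∑ i ∈ s, (f i : ℚ_[p]).valuation := by
  classical
  induction s using Finset.induction_on with
  | empty => simp
  | insert i s hi ih =>
    rw [Finset.prod_insert hi, Finset.sum_insert hi, Units.val_mul,
      Padic.valuation_mul (f i).ne_zero (Units.ne_zero _), ih]

/-- With `S` the sum of the valuations, the exponent `E` counts pairs with both valuations `1`, that
is `S (S - 1) / 2`. The pairs supply `unitChar (x i)` with exponent `S` minus its own valuation; the
extra product supplies the missing diagonal terms. -/
lemma pairProd_tameSymbol_mul_prod {n : ℕ} (x : Fin n → ℚ_[p]ˣ)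
    (hx : ∀ i, (x i : ℚ_[p]).valuation = 0 ∨ (x i : ℚ_[p]).valuation = 1) :
    ∃ E : ℤ, 2 * E = (∑ i, (x i : ℚ_[p]).valuation) * (∑ i, (x i : ℚ_[p]).valuation - 1) ∧
      pairProd tameSymbol x * ∏ i, unitChar (x i) ^ (x i : ℚ_[p]).valuation =
        unitChar (-1 : ℚ_[p]ˣ) ^ E * (∏ i, unitChar (x i)) ^ ∑ i, (x i : ℚ_[p]).valuation := by
  induction n with
  | zero => exact ⟨0, by simp [pairProd]⟩
  | succ n ih =>
    obtain ⟨E, hE, h⟩ := ih (fun i => x (Fin.succ i)) fun i => hx _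
    simp only [Fin.sum_univ_succ, Fin.prod_univ_succ]
    rw [pairProd_succ, ← tameSymbol_prod_right, tameSymbol, valuation_prod, map_prod]
    set S := ∑ i : Fin n, (x (Fin.succ i) : ℚ_[p]).valuation
    set P := ∏ i : Fin n, unitChar (x (Fin.succ i))
    refine ⟨E + (x 0 : ℚ_[p]).valuation * S, ?_, ?_⟩
    · rcases hx 0 with h0 | h0 <;> rw [h0] <;> linear_combination hE
    · rw [mul_zpow, zpow_add, zpow_add, zpow_add]
      calc _ = unitChar (-1 : ℚ_[p]ˣ) ^ ((x 0 : ℚ_[p]).valuation * S) * unitChar (x 0) ^ S *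
            P ^ (x 0 : ℚ_[p]).valuation * unitChar (x 0) ^ (x 0 : ℚ_[p]).valuation *
            (pairProd tameSymbol (fun i : Fin n => x (Fin.succ i)) *
              ∏ i : Fin n, unitChar (x (Fin.succ i)) ^ (x (Fin.succ i) : ℚ_[p]).valuation) := by
            ac_rfl
        _ = _ := by rw [h]; ac_rfl

lemma pairProd_tameSymbol_eq {n : ℕ} (x : Fin n → ℚ_[p]ˣ)
    (hx : ∀ i, (x i : ℚ_[p]).valuation = 0 ∨ (x i : ℚ_[p]).valuation = 1) {t : ℕ}
    (ht : ∑ i, (x i : ℚ_[p]).valuation = 2 * t) :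
    pairProd tameSymbol x =
      unitChar (-1 : ℚ_[p]ˣ) ^ t * ∏ i, unitChar (x i) ^ (x i : ℚ_[p]).valuation := by
  obtain ⟨E, hE, h⟩ := pairProd_tameSymbol_mul_prod x hx
  rw [ht] at hE h
  -- Here `E = t (2 t - 1)` has the parity of `t`.
  have h1 : E = t + 2 * (t * (t - 1)) := by linarith
  rw [intUnits_zpow_of_even _ (even_two_mul (t : ℤ)), mul_one, h1, zpow_add,
    intUnits_zpow_of_even _ (even_two_mul ((t : ℤ) * (t - 1))), mul_one, zpow_natCast] at h
  rw [← h, mul_assoc, ← sq, intUnits_sq, mul_one]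

end PairProduct

/-! ### The local invariant as a condition on the residue form. -/

section LocalInvariant

variable {p : ℕ} [hp : Fact p.Prime]

/-- A nonzero rational number as a unit of `ℚ_[p]`. -/
noncomputable def ratUnit (p : ℕ) [Fact p.Prime] : ℚˣ →* ℚ_[p]ˣ :=
  Units.map (Rat.castHom ℚ_[p]).toMonoidHom

lemma coe_ratUnit (a : ℚˣ) : (ratUnit p a : ℚ_[p]) = ((a : ℚ) : ℚ_[p]) := rfl

lemma hilbertSymbol_eq_tameSymbol (hodd : Odd p) (a b : ℚˣ) :
    hilbertSymbol p a b = (tameSymbol (ratUnit p a) (ratUnit p b) : ℤ) := by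
  have h := hilbertSolvable_iff_tameSymbol hodd (ratUnit p a) (ratUnit p b)
  rw [HilbertSolvable, coe_ratUnit, coe_ratUnit] at h
  rw [hilbertSymbol]
  split_ifs with h0
  · rw [h.1 h0, Units.val_one]
  · rcases Int.units_eq_one_or (tameSymbol (ratUnit p a) (ratUnit p b)) with h1 | h1
    · exact absurd (h.2 h1) h0
    · rw [h1]; rfl

lemma localInvariant_eq_pairProd (hodd : Odd p) {r : ℕ} (a : Fin r → ℚˣ) :
    localInvariant p (fun i => (a i : ℚ)) =
      (pairProd tameSymbol (fun i => ratUnit p (a i)) : ℤˣ) := by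
  rw [pairProd, Units.coe_prod]
  refine Finset.prod_congr rfl fun i _ => ?_
  rw [Units.coe_prod]
  exact Finset.prod_congr rfl fun j _ => hilbertSymbol_eq_tameSymbol hodd _ _

lemma hilbertSymbol_mul_sq (a b : ℚ) {c d : ℚ} (hc : c ≠ 0) (hd : d ≠ 0) :
    hilbertSymbol p (a * c ^ 2) (b * d ^ 2) = hilbertSymbol p a b := by
  have h : HilbertSolvable ((a * c ^ 2 : ℚ) : ℚ_[p]) ((b * d ^ 2 : ℚ) : ℚ_[p]) ↔
      HilbertSolvable (a : ℚ_[p]) (b : ℚ_[p]) := by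
    push_cast
    rw [hilbertSolvable_mul_sq_left_iff _ _ (by exact_mod_cast hc), hilbertSolvable_comm,
      hilbertSolvable_mul_sq_left_iff _ _ (by exact_mod_cast hd), hilbertSolvable_comm]
  classical
  unfold hilbertSymbol
  exact if_congr h rfl rfl

lemma localInvariant_mul_sq {r : ℕ} (a c : Fin r → ℚ) (hc : ∀ i, c i ≠ 0) :
    localInvariant p (fun i => a i * c i ^ 2) = localInvariant p a :=
  Finset.prod_congr rfl fun i _ => Finset.prod_congr rfl fun j _ =>
    hilbertSymbol_mul_sq _ _ (hc i) (hc j)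

lemma valuation_intCast_of_not_dvd {z : ℤ} (hz : ¬ (p : ℤ) ∣ z) : (z : ℚ_[p]).valuation = 0 := by
  rw [Padic.valuation_intCast, padicValInt.eq_zero_of_not_dvd hz]; rfl

lemma intCast_eq_mul {z : ℤ} (h : (p : ℤ) ∣ z) : (z : ℚ_[p]) = p * ((z / p : ℤ) : ℚ_[p]) := by
  conv_lhs => rw [← Int.mul_ediv_cancel' h]
  push_cast
  rfl

lemma valuation_intCast_of_dvd {z : ℤ} (h : (p : ℤ) ∣ z) (h' : ((z / p : ℤ) : ZMod p) ≠ 0) :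
    (z : ℚ_[p]).valuation = 1 := by
  have h1 : ¬ (p : ℤ) ∣ z / p := by rwa [← ZMod.intCast_zmod_eq_zero_iff_dvd]
  have h2 : ((z / p : ℤ) : ℚ_[p]) ≠ 0 := by
    intro h0
    apply h1
    rw [Int.cast_eq_zero.1 h0]
    exact dvd_zero _
  rw [intCast_eq_mul h, Padic.valuation_mul (by exact_mod_cast hp.out.ne_zero) h2,
    valuation_intCast_of_not_dvd h1, Padic.valuation_p, add_zero]

lemma toZMod_unitPart_of_dvd {z : ℤ} (h : (p : ℤ) ∣ z) (h' : ((z / p : ℤ) : ZMod p) ≠ 0) :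
    PadicInt.toZMod (unitPart (z : ℚ_[p])) = ((z / p : ℤ) : ZMod p) := by
  have hp0 : (p : ℚ_[p]) ≠ 0 := by exact_mod_cast hp.out.ne_zero
  have : unitPart (z : ℚ_[p]) = ((z / p : ℤ) : ℤ_[p]) := by
    apply PadicInt.ext
    rw [coe_unitPart, valuation_intCast_of_dvd h h', intCast_eq_mul h, zpow_neg_one]
    field_simp
    push_cast
    rfl
  rw [this, map_intCast]

variable {r : ℕ} {α : Fin r → ℤ}

/-- The pair product of tame symbols collapses to the quadratic character of the signed determinant
of the residue form, which is exactly the obstruction to a Lagrangian in rank `2 * t`. -/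
lemma localInvariant_eq_one_iff (hodd : Odd p) (hα : ∀ i, Squarefree (α i)) {t : ℕ}
    (ht : Fintype.card {i // (p : ℤ) ∣ α i} = 2 * t) :
    localInvariant p (fun i => (α i : ℚ)) = 1 ↔
      IsSquare ((-1) ^ t * ∏ i : {i // (p : ℤ) ∣ α i}, ((α i / p : ℤ) : ZMod p)) := by
  let a : Fin r → ℚˣ := fun i => Units.mk0 (α i : ℚ) (by exact_mod_cast (hα i).ne_zero)
  let x : Fin r → ℚ_[p]ˣ := fun i => ratUnit p (a i)
  have hxi : ∀ i, (x i : ℚ_[p]) = (α i : ℚ_[p]) := fun i => by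
    simp [x, a, coe_ratUnit]
  have hv : ∀ i, (x i : ℚ_[p]).valuation = if (p : ℤ) ∣ α i then 1 else 0 := by
    intro i
    rw [hxi]
    split_ifs with h
    · exact valuation_intCast_of_dvd h (residue_ne_zero hα h)
    · exact valuation_intCast_of_not_dvd h
  have h1 := localInvariant_eq_pairProd hodd a
  have h2 := pairProd_tameSymbol_eq x (fun i => by rw [hv]; split_ifs <;> simp) (t := t) (by
    rw [Finset.sum_congr rfl fun i _ => hv i, Finset.sum_boole, ← Fintype.card_subtype, ht]
    push_cast; rfl)
  change localInvariant p (fun i => (α i : ℚ)) = (pairProd tameSymbol x : ℤˣ) at h1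
  have h3 : ((pairProd tameSymbol x : ℤˣ) : ℤ) = quadraticChar (ZMod p)
      ((-1) ^ t * ∏ i : {i // (p : ℤ) ∣ α i}, ((α i / p : ℤ) : ZMod p)) := by
    rw [h2, map_mul, map_pow, map_prod, Units.val_mul, Units.val_pow_eq_pow_val, Units.coe_prod,
      coe_unitChar]
    congr 1
    · congr 1
      have : unitPart (((-1 : ℚ_[p]ˣ) : ℚ_[p])) = -1 := by
        apply PadicInt.ext
        rw [coe_unitPart, Units.val_neg, Units.val_one, padicValuation_neg_one]
        simp
      rw [this]; simp
    · have h4 : ∀ i, ((unitChar (x i) ^ (x i : ℚ_[p]).valuation : ℤˣ) : ℤ) =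
          if (p : ℤ) ∣ α i then quadraticChar (ZMod p) ((α i / p : ℤ) : ZMod p) else 1 := by
        intro i
        rw [hv]
        split_ifs with h
        · rw [zpow_one, coe_unitChar, hxi, toZMod_unitPart_of_dvd h (residue_ne_zero hα h)]
        · simp
      rw [Finset.prod_congr rfl fun i _ => h4 i, ← Finset.prod_filter]
      exact Finset.prod_subtype _ (by simp) _
  rw [h1, h3, quadraticChar_one_iff_isSquare]
  exact mul_ne_zero (pow_ne_zero _ (neg_ne_zero.2 one_ne_zero))
    (Finset.prod_ne_zero_iff.2 fun i _ => residue_ne_zero hα i.2)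

/-- Since the entries are squarefree, the number of them divisible by `p` is the `p`-adic valuation
of the determinant, which is even for a square up to sign. -/
lemma even_card_of_isNonzeroSquare (hα : ∀ i, Squarefree (α i))
    (h : IsNonzeroSquare |∏ i, (α i : ℚ)|) (p : ℕ) [Fact p.Prime] :
    ∃ t, Fintype.card {i // (p : ℤ) ∣ α i} = 2 * t := by
  obtain ⟨c, hc, h⟩ := h
  let x : Fin r → ℚ_[p]ˣ := fun i =>
    Units.mk0 (α i : ℚ_[p]) (by exact_mod_cast (hα i).ne_zero)
  have hv : ∀ i, (x i : ℚ_[p]).valuation = if (p : ℤ) ∣ α i then 1 else 0 := by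
    intro i
    split_ifs with h
    · exact valuation_intCast_of_dvd h (residue_ne_zero hα h)
    · exact valuation_intCast_of_not_dvd h
  have h1 := valuation_prod Finset.univ x
  rw [Finset.sum_congr rfl fun i _ => hv i, Finset.sum_boole, ← Fintype.card_subtype] at h1
  have h2 : ((∏ i, x i : ℚ_[p]ˣ) : ℚ_[p]) = (c : ℚ_[p]) ^ 2 ∨
      ((∏ i, x i : ℚ_[p]ˣ) : ℚ_[p]) = -1 * (c : ℚ_[p]) ^ 2 := by
    have h3 : ((∏ i, x i : ℚ_[p]ˣ) : ℚ_[p]) = ((∏ i, (α i : ℚ) : ℚ) : ℚ_[p]) := by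
      rw [Units.coe_prod]
      push_cast
      rfl
    rw [h3]
    rcases abs_choice (∏ i, (α i : ℚ)) with h4 | h4
    · left
      rw [← h4, h]; push_cast; rfl
    · right
      rw [← neg_neg (∏ i, (α i : ℚ)), ← h4, h]; push_cast; ring
  have hc' : (c : ℚ_[p]) ≠ 0 := by exact_mod_cast hc
  have h5 : ((∏ i, x i : ℚ_[p]ˣ) : ℚ_[p]).valuation = 2 * (c : ℚ_[p]).valuation := by
    rcases h2 with h2 | h2
    · rw [h2, Padic.valuation_pow]; rfl
    · rw [h2, Padic.valuation_mul (by simp) (pow_ne_zero 2 hc'), padicValuation_neg_one,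
        Padic.valuation_pow, zero_add]
      rfl
  rw [h5] at h1
  have h6 : Even (Fintype.card {i // (p : ℤ) ∣ α i}) := by
    rw [← Int.even_coe_nat, ← h1]
    exact even_two_mul _
  obtain ⟨t, ht⟩ := h6
  exact ⟨t, by omega⟩

end LocalInvariant

/-! ### The local criterion for a rational diagonal form. -/

section DiagonalCriterion

lemma isInnerProductSpace_of_nondegenerate {F : Type u} [Field F] {V : Type v} [AddCommGroup V]
    [Module F V] [FiniteDimensional F V] {b : LinearMap.BilinForm F V} (hb : b.Nondegenerate)
    (hs : b.IsSymm) : IsInnerProductSpace b where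
  finite := inferInstance
  projective := inferInstance
  symm := hs
  bijective := (b.toDual hb).bijective

lemma exists_squarefree_mul_sq {q : ℚ} (hq : q ≠ 0) :
    ∃ (α : ℤ) (c : ℚ), Squarefree α ∧ c ≠ 0 ∧ q = α * c ^ 2 := by
  have hd : (q.den : ℚ) ≠ 0 := by exact_mod_cast q.den_ne_zero
  have hn : q.num * q.den ≠ 0 := mul_ne_zero (Rat.num_ne_zero.2 hq) (by exact_mod_cast q.den_ne_zero)
  obtain ⟨a, b, hab, ha⟩ := Nat.sq_mul_squarefree (q.num * q.den).natAbs
  have hb : b ≠ 0 := by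
    rintro rfl
    rw [zero_pow two_ne_zero, zero_mul, eq_comm, Int.natAbs_eq_zero] at hab
    exact hn hab
  -- Modulo squares `q` is the integer `q.num * q.den`, whose squarefree part is then taken.
  have hq' : q = (q.num * q.den : ℤ) / (q.den : ℚ) ^ 2 := by
    push_cast
    conv_lhs => rw [← Rat.num_div_den q]
    field_simp
  have hab' : ((q.num * q.den).natAbs : ℚ) = b ^ 2 * a := by rw [← hab]; push_cast; rfl
  rcases Int.natAbs_eq (q.num * q.den) with h | h
  · refine ⟨a, b / q.den, Int.squarefree_natCast.2 ha, div_ne_zero (by exact_mod_cast hb) hd, ?_⟩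
    rw [h, Int.cast_natCast, hab'] at hq'
    exact hq'.trans (by push_cast; ring)
  · refine ⟨-a, b / q.den, Int.squarefree_natAbs.1 (by simpa using ha),
      div_ne_zero (by exact_mod_cast hb) hd, ?_⟩
    rw [h, Int.cast_neg, Int.cast_natCast, hab'] at hq'
    exact hq'.trans (by push_cast; ring)

/-- Modulo `2` the only nonzero scalar is `1 = -1`, so even rank alone makes the form a sum of
copies of `⟨1, -1⟩`; hence no condition arises at `p = 2`. -/
lemma hasLagrangian_diagForm_of_two {ι : Type*} [Fintype ι] {a : ι → ZMod 2} (ha : ∀ i, a i ≠ 0)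
    {m : ℕ} (hm : Fintype.card ι = 2 * m) : HasLagrangian (diagForm a) := by
  let τ : Fin m ⊕ Fin m ≃ ι := Fintype.equivOfCardEq (by simp [hm]; omega)
  have h1 : a ∘ τ = Sum.elim (fun _ => 1) fun _ => -1 := by
    have h2 : ∀ x : ZMod 2, x ≠ 0 → x = 1 := by decide
    have h3 : (-1 : ZMod 2) = 1 := by decide
    ext (i | i)
    · exact h2 _ (ha _)
    · exact (h2 _ (ha _)).trans h3.symm
  have h4 := diagForm_equivalent_comp τ a
  rw [h1] at h4
  exact (hasLagrangian_diagForm_sum m).of_equivalent h4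

theorem hasSelfDualLattice_diagForm_intCast_iff {r : ℕ} {α : Fin r → ℤ}
    (hα : ∀ i, Squarefree (α i)) :
    HasSelfDualLattice (diagForm fun i => (α i : ℚ)) ↔ IsNonzeroSquare |∏ i, (α i : ℚ)| ∧
      ∀ (p : ℕ) [Fact p.Prime], Odd p → localInvariant p (fun i => (α i : ℚ)) = 1 := by
  constructor
  · intro h
    have hnd : (diagForm fun i => (α i : ℚ)).Nondegenerate :=
      diagForm_nondegenerate fun i => by exact_mod_cast (hα i).ne_zero
    have hsq := h.isNonzeroSquare_abs_det
      (isInnerProductSpace_of_nondegenerate hnd (diagForm_isSymm _)) (Pi.basisFun ℚ (Fin r))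
    rw [toMatrix_basisFun_diagForm, Matrix.det_diagonal] at hsq
    refine ⟨hsq, fun p _ hodd => ?_⟩
    obtain ⟨t, ht, hsq'⟩ := (h.hasLagrangian_residueForm hα p).isSquare
      fun i => residue_ne_zero hα i.2
    exact (localInvariant_eq_one_iff hodd hα ht).2 hsq'
  · rintro ⟨hsq, h⟩
    refine hasSelfDualLattice_diagForm_of_hasLagrangian hα fun p hp => ?_
    obtain ⟨t, ht⟩ := even_card_of_isNonzeroSquare hα hsq p
    rcases hp.out.eq_two_or_odd' with rfl | hodd
    · exact hasLagrangian_diagForm_of_two (fun i => residue_ne_zero hα i.2) ht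
    · exact hasLagrangian_diagForm (ringChar_zmod_ne_two hodd) (fun i => residue_ne_zero hα i.2) ht
        ((localInvariant_eq_one_iff hodd hα ht).1 (h p hodd))

lemma IsNonzeroSquare.mul_sq {x c : ℚ} (hc : c ≠ 0) (h : IsNonzeroSquare x) :
    IsNonzeroSquare (x * c ^ 2) := by
  obtain ⟨d, hd, rfl⟩ := h
  exact ⟨d * c, mul_ne_zero hd hc, by ring⟩

lemma isNonzeroSquare_mul_sq_iff {x c : ℚ} (hc : c ≠ 0) :
    IsNonzeroSquare (x * c ^ 2) ↔ IsNonzeroSquare x := by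
  refine ⟨fun h => ?_, IsNonzeroSquare.mul_sq hc⟩
  have := h.mul_sq (inv_ne_zero hc)
  rwa [mul_assoc, ← mul_pow, mul_inv_cancel₀ hc, one_pow, mul_one] at this

theorem hasSelfDualLattice_diagForm_iff {r : ℕ} {a : Fin r → ℚ} (ha : ∀ i, a i ≠ 0) :
    HasSelfDualLattice (diagForm a) ↔ IsNonzeroSquare |∏ i, a i| ∧
      ∀ (p : ℕ) [Fact p.Prime], Odd p → localInvariant p a = 1 := by
  choose α c hα hc hac using fun i => exists_squarefree_mul_sq (ha i)
  obtain rfl : a = fun i => (α i : ℚ) * c i ^ 2 := funext hac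
  obtain ⟨f⟩ := diagForm_equivalent_mul_sq (fun i => (α i : ℚ)) c hc
  rw [hasSelfDualLattice_iff_of_isometry f.toLinearEquiv f.map_app',
    hasSelfDualLattice_diagForm_intCast_iff hα, Finset.prod_mul_distrib, Finset.prod_pow, abs_mul,
    abs_of_nonneg (sq_nonneg (∏ i, c i)),
    isNonzeroSquare_mul_sq_iff (Finset.prod_ne_zero_iff.2 fun i _ => hc i)]
  refine and_congr_right fun _ => forall₃_congr fun p _ _ => ?_
  rw [localInvariant_mul_sq _ _ hc]

end DiagonalCriterion

/-! ### Effect of rescaling the form on the local invariants. -/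

section Scaling

variable {p : ℕ} [hp : Fact p.Prime] {r : ℕ}

lemma ratUnit_neg_one : ratUnit p (-1) = -1 := by
  ext
  simp [coe_ratUnit]

lemma tameSymbol_neg_one_neg_one : tameSymbol (-1 : ℚ_[p]ˣ) (-1) = 1 := by
  simp [tameSymbol, padicValuation_neg_one]

lemma tameSymbol_mul_sq_right (a b c : ℚ_[p]ˣ) : tameSymbol a (b * c ^ 2) = tameSymbol a b := by
  rw [tameSymbol_mul_right, tameSymbol_comm a (c ^ 2), tameSymbol_sq_left, mul_one]

lemma pairProd_ratUnit_mul_of_odd {c s t : ℚˣ} {a : Fin r → ℚˣ} (hc : c = s ^ 2 ∨ c = -1 * s ^ 2)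
    (ha : ∏ i, a i = t ^ 2) :
    pairProd tameSymbol (fun i => ratUnit p (c * a i)) =
      pairProd tameSymbol fun i => ratUnit p (a i) := by
  have h := pairProd_tameSymbol_mul (ratUnit p c) fun i => ratUnit p (a i)
  have h1 : tameSymbol (ratUnit p c) (∏ i, ratUnit p (a i)) = 1 := by
    rw [← map_prod, ha, map_pow, tameSymbol_comm, tameSymbol_sq_left]
  have h2 : tameSymbol (ratUnit p c) (ratUnit p c) = 1 := by
    rw [tameSymbol_self]
    rcases hc with rfl | rfl
    · rw [map_pow, tameSymbol_sq_left]
    · rw [map_mul, map_pow, tameSymbol_comm, tameSymbol_mul_sq_right, ratUnit_neg_one,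
        tameSymbol_neg_one_neg_one]
  rw [h1, h2] at h
  simpa using h

lemma intUnits_pow_of_even (x : ℤˣ) {n : ℕ} (hn : Even n) : x ^ n = 1 := by
  obtain ⟨k, rfl⟩ := hn
  rw [← two_mul, pow_mul, intUnits_sq, one_pow]

lemma intUnits_pow_of_odd (x : ℤˣ) {n : ℕ} (hn : Odd n) : x ^ n = x := by
  obtain ⟨k, rfl⟩ := hn
  rw [pow_succ, pow_mul, intUnits_sq, one_pow, one_mul]

/-- For even `r` the exponent `r - 1` of `(c, d)` is odd, so one factor survives, and `(c, c) = (c,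
-1)`. The parity of `r.choose 2`, governed by `r` modulo 4, then decides whether this cancels
against `(c, d)` when `d` is a square up to sign. -/
lemma pairProd_ratUnit_mul_of_even (hr : Even r) (c : ℚˣ) (a : Fin r → ℚˣ) :
    pairProd tameSymbol (fun i => ratUnit p (c * a i)) =
      tameSymbol (ratUnit p c) (-1) ^ r.choose 2 *
        tameSymbol (ratUnit p c) (ratUnit p (∏ i, a i)) *
        pairProd tameSymbol fun i => ratUnit p (a i) := by
  have h := pairProd_tameSymbol_mul (ratUnit p c) fun i => ratUnit p (a i)
  rw [← map_prod, tameSymbol_self, intUnits_pow_of_even _ hr, mul_one] at h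
  rw [mul_right_comm, ← h, mul_assoc, ← sq, intUnits_sq, mul_one]
  simp only [map_mul]

lemma even_choose_two (h : r % 4 = 0) : Even (r.choose 2) := by
  obtain ⟨q, rfl⟩ : ∃ q, r = 4 * q := ⟨r / 4, by omega⟩
  rw [Nat.choose_two_right, Nat.div_eq_of_eq_mul_left two_pos
    (show 4 * q * (4 * q - 1) = (2 * (q * (4 * q - 1))) * 2 by ring)]
  exact even_two_mul _

lemma odd_choose_two (h : r % 4 = 2) : Odd (r.choose 2) := by
  obtain ⟨q, rfl⟩ : ∃ q, r = 4 * q + 2 := ⟨r / 4, by omega⟩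
  rw [Nat.choose_two_right, Nat.div_eq_of_eq_mul_left two_pos
    (show (4 * q + 2) * (4 * q + 2 - 1) = (2 * (4 * q ^ 2 + 3 * q) + 1) * 2 by
      rw [show 4 * q + 2 - 1 = 4 * q + 1 by omega]; ring)]
  exact odd_two_mul_add_one _

lemma pairProd_ratUnit_mul_of_split {s : ℚˣ} {a : Fin r → ℚˣ} (c : ℚˣ)
    (h : r % 4 = 0 ∧ ∏ i, a i = s ^ 2 ∨ r % 4 = 2 ∧ ∏ i, a i = -1 * s ^ 2) :
    pairProd tameSymbol (fun i => ratUnit p (c * a i)) =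
      pairProd tameSymbol fun i => ratUnit p (a i) := by
  rcases h with ⟨hr, h⟩ | ⟨hr, h⟩
  · rw [pairProd_ratUnit_mul_of_even (Nat.even_iff.2 (by omega)),
      intUnits_pow_of_even _ (even_choose_two hr), h, map_pow, tameSymbol_comm, tameSymbol_sq_left,
      one_mul, one_mul]
  · rw [pairProd_ratUnit_mul_of_even (Nat.even_iff.2 (by omega)),
      intUnits_pow_of_odd _ (odd_choose_two hr), h, map_mul, map_pow, tameSymbol_mul_sq_right,
      ratUnit_neg_one, ← sq, intUnits_sq, one_mul]

lemma pairProd_ratUnit_mul_of_nonsplit {s : ℚˣ} {a : Fin r → ℚˣ} (c : ℚˣ)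
    (h : r % 4 = 0 ∧ ∏ i, a i = -1 * s ^ 2 ∨ r % 4 = 2 ∧ ∏ i, a i = s ^ 2) :
    pairProd tameSymbol (fun i => ratUnit p (c * a i)) =
      tameSymbol (ratUnit p c) (-1) * pairProd tameSymbol fun i => ratUnit p (a i) := by
  rcases h with ⟨hr, h⟩ | ⟨hr, h⟩
  · rw [pairProd_ratUnit_mul_of_even (Nat.even_iff.2 (by omega)),
      intUnits_pow_of_even _ (even_choose_two hr), h, map_mul, map_pow, tameSymbol_mul_sq_right,
      ratUnit_neg_one, one_mul]
  · rw [pairProd_ratUnit_mul_of_even (Nat.even_iff.2 (by omega)),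
      intUnits_pow_of_odd _ (odd_choose_two hr), h, map_pow, tameSymbol_comm _ (ratUnit p s ^ 2),
      tameSymbol_sq_left, mul_one]

lemma unitChar_neg_one (hodd : Odd p) :
    unitChar (-1 : ℚ_[p]ˣ) = if p % 4 = 1 then 1 else -1 := by
  have h1 : unitChar (-1 : ℚ_[p]ˣ) = 1 ↔ p % 4 = 1 := by
    have h2 : unitPart (((-1 : ℚ_[p]ˣ) : ℚ_[p])) = -1 := by
      apply PadicInt.ext
      rw [coe_unitPart, Units.val_neg, Units.val_one, padicValuation_neg_one]
      simp
    rw [unitChar_eq_one_iff, h2, map_neg, map_one, ZMod.exists_sq_eq_neg_one_iff]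
    have := Nat.odd_iff.1 hodd
    omega
  split_ifs with h
  · exact h1.2 h
  · exact (Int.units_eq_one_or _).resolve_left fun h3 => h (h1.1 h3)

lemma tameSymbol_neg_one_right (a : ℚ_[p]ˣ) :
    tameSymbol a (-1) = unitChar (-1 : ℚ_[p]ˣ) ^ (a : ℚ_[p]).valuation := by
  simp [tameSymbol, padicValuation_neg_one]

lemma pairProd_ratUnit_eq_one {a : Fin r → ℚˣ}
    (h : ∀ i, ¬ (p : ℤ) ∣ (a i : ℚ).num * (a i : ℚ).den) :
    pairProd tameSymbol (fun i => ratUnit p (a i)) = 1 := by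
  have hv : ∀ i, (ratUnit p (a i) : ℚ_[p]).valuation = 0 := by
    intro i
    rw [coe_ratUnit, Padic.valuation_ratCast, padicValRat_def,
      padicValInt.eq_zero_of_not_dvd fun h1 => h i (h1.mul_right _),
      padicValNat.eq_zero_of_not_dvd fun h1 => h i ((Int.natCast_dvd_natCast.2 h1).mul_left _)]
    simp
  refine Finset.prod_eq_one fun i _ => Finset.prod_eq_one fun j _ => ?_
  simp [tameSymbol, hv]

/-- A rational number has prescribed valuations in `{0, 1}` at a finite set of primes. -/
lemma exists_valuation_eq (P : Finset ℕ) (hP : ∀ q ∈ P, q.Prime) :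
    ∃ c : ℚˣ, ∀ (p : ℕ) [Fact p.Prime],
      (ratUnit p c : ℚ_[p]).valuation = if p ∈ P then 1 else 0 := by
  classical
  refine ⟨∏ q ∈ P.attach, Units.mk0 ((q : ℕ) : ℚ) (by
    exact_mod_cast (hP q q.2).ne_zero), fun p hp => ?_⟩
  rw [map_prod, valuation_prod]
  have : ∀ q ∈ P.attach, (ratUnit p (Units.mk0 ((q : ℕ) : ℚ) (by
      exact_mod_cast (hP q q.2).ne_zero)) : ℚ_[p]).valuation = if (q : ℕ) = p then 1 else 0 := by
    intro q _
    rw [coe_ratUnit, Units.val_mk0, Rat.cast_natCast, Padic.valuation_natCast]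
    have hq : Fact (q : ℕ).Prime := ⟨hP q q.2⟩
    split_ifs with h
    · rw [h, padicValNat_self]; rfl
    · rw [padicValNat_primes (Ne.symm h)]; rfl
  rw [Finset.sum_congr rfl this, Finset.sum_attach P fun q => if q = p then (1 : ℤ) else 0,
    Finset.sum_ite_eq']

end Scaling

/-! ### Orientations as scalings of a diagonal form. -/

section Integrality

lemma diagForm_equivFun {F : Type u} [Field F] {V : Type v} [AddCommGroup V] [Module F V]
    {b : LinearMap.BilinForm F V} {r : ℕ} {e : Basis (Fin r) F V} {a : Fin r → F}
    (h : LinearMap.BilinForm.toMatrix e b = Matrix.diagonal a) (x y : V) :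
    diagForm a (e.equivFun x) (e.equivFun y) = b x y := by
  have hxy := LinearMap.BilinForm.dotProduct_toMatrix_mulVec e b (e.equivFun x) (e.equivFun y)
  rw [LinearEquiv.symm_apply_apply, LinearEquiv.symm_apply_apply, h] at hxy
  rw [← hxy, diagForm_apply, dotProduct]
  exact Finset.sum_congr rfl fun i _ => by
    rw [Matrix.mulVec_diagonal]; ring

variable {A : Type v} [Ring A] [Algebra ℚ A] {𝒜 : ℕ → Submodule ℚ A} [GradedAlgebra 𝒜] {k : ℕ}
  (h : IsPDA 𝒜 (4 * k)) {ω : 𝒜 (4 * k)} (hω : ω ≠ 0)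

lemma poincareForm_smul_orientation {c : ℚ} (hc : c ≠ 0) :
    poincareForm h (c • ω) (smul_ne_zero hc hω) = c⁻¹ • poincareForm h ω hω := by
  ext x y
  have hω' : (ω : A) ≠ 0 := fun h0 => hω (Subtype.ext h0)
  apply smul_left_injective ℚ hω'
  have h1 := poincareForm_spec h ω hω x y
  have h2 := poincareForm_spec h (c • ω) (smul_ne_zero hc hω) x y
  rw [h1, Submodule.coe_smul, smul_smul] at h2
  have h3 := smul_left_injective ℚ hω' h2
  simp only [LinearMap.smul_apply, smul_eq_mul]
  rw [h3]
  congr 1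
  field_simp

variable {r : ℕ} {e : Basis (Fin r) ℚ (𝒜 (2 * k))} {a : Fin r → ℚ}

lemma diagonal_ne_zero
    (ha : LinearMap.BilinForm.toMatrix e (poincareForm h ω hω) = Matrix.diagonal a) (i : Fin r) :
    a i ≠ 0 := by
  intro h0
  have h1 := (isInnerProductSpace_poincareForm h ω hω).bijective.1 (a₁ := e i) (a₂ := 0) (by
    rw [map_zero]
    refine e.ext fun j => ?_
    rw [← LinearMap.BilinForm.toMatrix_apply, ha, Matrix.diagonal_apply]
    simp [h0])
  exact e.ne_zero i h1

/-- The top degree is one-dimensional, so every orientation is a multiple of `ω`, and multiplying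
`ω` by `c` multiplies the form by `c⁻¹`. -/
lemma isIntegral_iff
    (ha : LinearMap.BilinForm.toMatrix e (poincareForm h ω hω) = Matrix.diagonal a) :
    IsIntegral h ↔ ∃ c : ℚ, c ≠ 0 ∧ IsNonzeroSquare |∏ i, c * a i| ∧
      ∀ (p : ℕ) [Fact p.Prime], Odd p → localInvariant p (fun i => c * a i) = 1 := by
  have ha0 := diagonal_ne_zero h hω ha
  have key : ∀ (c : ℚ) (hc : c ≠ 0), MemWittInt (poincareForm h (c • ω) (smul_ne_zero hc hω)) ↔
      IsNonzeroSquare |∏ i, c⁻¹ * a i| ∧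
      ∀ (p : ℕ) [Fact p.Prime], Odd p → localInvariant p (fun i => c⁻¹ * a i) = 1 := by
    intro c hc
    rw [memWittInt_iff (isInnerProductSpace_poincareForm h _ _),
      ← hasSelfDualLattice_diagForm_iff fun i => mul_ne_zero (inv_ne_zero hc) (ha0 i)]
    refine hasSelfDualLattice_iff_of_isometry e.equivFun fun x y => ?_
    rw [poincareForm_smul_orientation h hω hc]
    refine diagForm_equivFun ?_ x y
    rw [map_smul, ha]
    ext i j
    simp [Matrix.diagonal_apply]
  constructor
  · rintro ⟨ω', hω', hmem⟩
    obtain ⟨c, rfl⟩ := exists_smul_eq_of_finrank_eq_one h.finrank_top hω ω'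
    have hc : c ≠ 0 := by
      rintro rfl
      exact hω' (zero_smul _ _)
    exact ⟨c⁻¹, inv_ne_zero hc, (key c hc).1 hmem⟩
  · rintro ⟨c, hc, hmem⟩
    refine ⟨c⁻¹ • ω, smul_ne_zero (inv_ne_zero hc) hω, (key c⁻¹ (inv_ne_zero hc)).2 ?_⟩
    rwa [inv_inv]

lemma exists_hasDiscriminant_one (hr : Odd (finrank ℚ (𝒜 (2 * k)))) :
    ∃ (c : ℚ) (hc : c ≠ 0),
      HasDiscriminant (poincareForm h (c • ω) (smul_ne_zero hc hω)) 1 := by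
  have := h.finite (2 * k)
  let e := finBasis ℚ (𝒜 (2 * k))
  obtain ⟨m, hm⟩ := hr
  set d := (LinearMap.BilinForm.toMatrix e (poincareForm h ω hω)).det with hd
  have hd0 : d ≠ 0 := by
    have h1 := (isInnerProductSpace_poincareForm h ω hω).nondegenerate
    exact (LinearMap.BilinForm.nondegenerate_iff_det_ne_zero e).1 h1
  -- Scaling the orientation by the determinant `d` gives determinant `d * d⁻¹ ^ (2 * m + 1)`, which
  -- is the square of `d⁻¹ ^ m`.
  refine ⟨d, hd0, fun n f => ?_⟩
  obtain rfl : n = finrank ℚ (𝒜 (2 * k)) := by simpa using (finrank_eq_card_basis f).symm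
  have h2 := LinearMap.BilinForm.toMatrix_mul_basis_toMatrix
    (B := poincareForm h (d • ω) (smul_ne_zero hd0 hω)) e f
  have hδ : (e.toMatrix f).det ≠ 0 := by
    intro h0
    have := congrArg Matrix.det (e.toMatrix_mul_toMatrix_flip f)
    rw [Matrix.det_mul, h0] at this
    simp at this
  refine ⟨_, ⟨(e.toMatrix f).det * (d⁻¹) ^ m, mul_ne_zero hδ (pow_ne_zero _ (inv_ne_zero hd0)), rfl⟩, ?_⟩
  have hpow : d⁻¹ ^ finrank ℚ (𝒜 (2 * k)) = d⁻¹ ^ (2 * m + 1) := congrArg _ hm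
  rw [← h2, Matrix.det_mul, Matrix.det_mul, Matrix.det_transpose,
    poincareForm_smul_orientation h hω hd0, map_smul, Matrix.det_smul, ← hd, Fintype.card_fin, hpow]
  linear_combination (e.toMatrix f).det ^ 2 * d⁻¹ ^ (2 * m) * inv_mul_cancel₀ hd0

end Integrality

/-! ### Solvability of the local conditions by some rescaling. -/

section Criteria

variable {r : ℕ} {a : Fin r → ℚ}

lemma localInvariant_eq_one_iff_pairProd {p : ℕ} [Fact p.Prime] (hodd : Odd p) (a : Fin r → ℚˣ) :
    localInvariant p (fun i => (a i : ℚ)) = 1 ↔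
      pairProd tameSymbol (fun i => ratUnit p (a i)) = 1 := by
  rw [localInvariant_eq_pairProd hodd, Units.val_eq_one]

lemma isNonzeroSquare_abs_prod_mul_iff (hr : Even r) {c : ℚ} (hc : c ≠ 0) :
    IsNonzeroSquare |∏ i, c * a i| ↔ IsNonzeroSquare |∏ i, a i| := by
  obtain ⟨m, hm⟩ := hr
  have hpow : c ^ r = (c ^ m) ^ 2 := by rw [hm, ← mul_two, pow_mul]
  rw [Finset.prod_mul_distrib, Finset.prod_const, Finset.card_fin, hpow, abs_mul,
    abs_of_nonneg (sq_nonneg _), mul_comm,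
    isNonzeroSquare_mul_sq_iff (pow_ne_zero m hc)]

lemma exists_scaling_iff_of_odd (hr : Odd r) (ha : ∀ i, a i ≠ 0) (hsq : IsNonzeroSquare (∏ i, a i)) :
    (∃ c : ℚ, c ≠ 0 ∧ IsNonzeroSquare |∏ i, c * a i| ∧
      ∀ (p : ℕ) [Fact p.Prime], Odd p → localInvariant p (fun i => c * a i) = 1) ↔
    ∀ (p : ℕ) [Fact p.Prime], Odd p → localInvariant p a = 1 := by
  obtain ⟨t, ht, hat⟩ := hsq
  constructor
  · rintro ⟨c, hc, ⟨d, hd, hcd⟩, h⟩ p _ hodd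
    obtain ⟨m, rfl⟩ := hr
    -- In odd rank the determinant condition on the scaled form forces `c` to be a square up to
    -- sign, which leaves the invariants at odd primes unchanged.
    have habs : |c| = (d / (t * c ^ m)) ^ 2 := by
      rw [Finset.prod_mul_distrib, Finset.prod_const, Finset.card_fin, hat, pow_succ, abs_mul,
        abs_mul, abs_of_nonneg (sq_nonneg t), abs_of_nonneg (Even.pow_nonneg ⟨m, two_mul m⟩ c)] at hcd
      rw [div_pow, ← hcd, mul_pow, ← pow_mul, mul_comm m 2]
      field_simp
    have hs0 : d / (t * c ^ m) ≠ 0 := div_ne_zero hd (mul_ne_zero ht (pow_ne_zero m hc))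
    let a' : Fin (2 * m + 1) → ℚˣ := fun i => Units.mk0 (a i) (ha i)
    have h1 := (localInvariant_eq_one_iff_pairProd hodd
      fun i => Units.mk0 c hc * a' i).1 (h p hodd)
    rw [pairProd_ratUnit_mul_of_odd (s := Units.mk0 _ hs0) (t := Units.mk0 t ht)] at h1
    · exact (localInvariant_eq_one_iff_pairProd hodd a').2 h1
    · rcases abs_choice c with h2 | h2
      · left
        ext
        simp only [Units.val_mk0, Units.val_pow_eq_pow_val]
        rw [← habs, h2]
      · right
        ext
        simp only [Units.val_mk0, Units.val_pow_eq_pow_val, Units.val_mul, Units.val_neg,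
          Units.val_one]
        rw [← habs, h2]; ring
    · ext
      rw [Units.coe_prod]
      exact hat
  · intro h
    refine ⟨1, one_ne_zero, ?_⟩
    simp only [one_mul]
    exact ⟨⟨t, ht, by rw [hat, abs_of_nonneg (sq_nonneg t)]⟩, h⟩

lemma prod_eq_of_sign (ha : ∀ i, a i ≠ 0) {s : ℚ} (hs : s ≠ 0) (hs' : |∏ i, a i| = s ^ 2) :
    (SignType.sign (∏ i, a i) = 1 →
      ∏ i, Units.mk0 (a i) (ha i) = (Units.mk0 s hs) ^ 2) ∧
    (SignType.sign (∏ i, a i) = -1 →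
      ∏ i, Units.mk0 (a i) (ha i) = -1 * (Units.mk0 s hs) ^ 2) := by
  constructor
  · intro h
    ext
    rw [Units.coe_prod]
    simp only [Units.val_mk0, Units.val_pow_eq_pow_val]
    rw [← hs', abs_of_pos (sign_eq_one_iff.1 h)]
  · intro h
    ext
    rw [Units.coe_prod]
    simp only [Units.val_mk0, Units.val_pow_eq_pow_val, Units.val_mul, Units.val_neg,
      Units.val_one]
    rw [← hs', abs_of_neg (sign_eq_neg_one_iff.1 h)]
    ring

lemma exists_scaling_iff_of_split (ha : ∀ i, a i ≠ 0)
    (hr : r % 4 = 0 ∧ SignType.sign (∏ i, a i) = 1 ∨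
      r % 4 = 2 ∧ SignType.sign (∏ i, a i) = -1) :
    (∃ c : ℚ, c ≠ 0 ∧ IsNonzeroSquare |∏ i, c * a i| ∧
      ∀ (p : ℕ) [Fact p.Prime], Odd p → localInvariant p (fun i => c * a i) = 1) ↔
    IsNonzeroSquare |∏ i, a i| ∧
      ∀ (p : ℕ) [Fact p.Prime], Odd p → localInvariant p a = 1 := by
  constructor
  · rintro ⟨c, hc, hsq, h⟩
    rw [isNonzeroSquare_abs_prod_mul_iff (Nat.even_iff.2 (by omega)) hc] at hsq
    refine ⟨hsq, fun p _ hodd => ?_⟩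
    obtain ⟨s, hs, hs'⟩ := hsq
    have h1 := (localInvariant_eq_one_iff_pairProd hodd
      fun i => Units.mk0 c hc * Units.mk0 (a i) (ha i)).1 (h p hodd)
    have h2 := prod_eq_of_sign ha hs hs'
    rw [pairProd_ratUnit_mul_of_split (s := Units.mk0 s hs) _
        (hr.imp (And.imp_right h2.1) (And.imp_right h2.2))] at h1
    exact (localInvariant_eq_one_iff_pairProd hodd fun i => Units.mk0 (a i) (ha i)).2 h1
  · intro h
    refine ⟨1, one_ne_zero, ?_⟩
    simpa only [one_mul] using h

/-- Rescaling by `c` multiplies the invariant at `p` by the quadratic character of `-1` to the power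
of the valuation of `c`. This is trivial for `p ≡ 1` mod 4 and a sign of free choice for `p ≡ 3` mod
4, so only the former primes give conditions. -/
lemma exists_scaling_iff_of_nonsplit (ha : ∀ i, a i ≠ 0)
    (hr : r % 4 = 0 ∧ SignType.sign (∏ i, a i) = -1 ∨
      r % 4 = 2 ∧ SignType.sign (∏ i, a i) = 1) :
    (∃ c : ℚ, c ≠ 0 ∧ IsNonzeroSquare |∏ i, c * a i| ∧
      ∀ (p : ℕ) [Fact p.Prime], Odd p → localInvariant p (fun i => c * a i) = 1) ↔
    IsNonzeroSquare |∏ i, a i| ∧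
      ∀ (p : ℕ) [Fact p.Prime], p % 4 = 1 → localInvariant p a = 1 := by
  classical
  let a' : Fin r → ℚˣ := fun i => Units.mk0 (a i) (ha i)
  have heven : Even r := Nat.even_iff.2 (by omega)
  have key : IsNonzeroSquare |∏ i, a i| → ∀ (c : ℚˣ) (p : ℕ) [Fact p.Prime], Odd p →
      (localInvariant p (fun i => c * a i) = 1 ↔ unitChar (-1 : ℚ_[p]ˣ) ^
        (ratUnit p c : ℚ_[p]).valuation * pairProd tameSymbol (fun i => ratUnit p (a' i)) = 1) := by
    rintro ⟨s, hs, hs'⟩ c p _ hodd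
    have h2 := prod_eq_of_sign ha hs hs'
    rw [← tameSymbol_neg_one_right, ← pairProd_ratUnit_mul_of_nonsplit (s := Units.mk0 s hs) c
      (hr.imp (And.imp_right h2.2) (And.imp_right h2.1))]
    exact localInvariant_eq_one_iff_pairProd hodd fun i => c * a' i
  constructor
  · rintro ⟨c, hc, hsq, h⟩
    rw [isNonzeroSquare_abs_prod_mul_iff heven hc] at hsq
    refine ⟨hsq, fun p _ hp => ?_⟩
    have hodd : Odd p := Nat.odd_iff.2 (by omega)
    have h1 := (key hsq (Units.mk0 c hc) p hodd).1 (h p hodd)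
    rw [unitChar_neg_one hodd, if_pos hp, one_zpow, one_mul] at h1
    exact (localInvariant_eq_one_iff_pairProd hodd a').2 h1
  · rintro ⟨hsq, h⟩
    let N : ℤ := ∏ i, (a i).num * (a i).den
    have hN : N ≠ 0 := Finset.prod_ne_zero_iff.2 fun i _ =>
      mul_ne_zero (Rat.num_ne_zero.2 (ha i)) (by exact_mod_cast (a i).den_ne_zero)
    -- These are the primes where the sign must be corrected. Outside the prime factors of `N` all
    -- entries are units and the invariant is `1`, so finitely many primes suffice for `c`.
    let P : Finset ℕ := N.natAbs.primeFactors.filter fun p =>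
      ∃ _ : Fact p.Prime, p % 4 = 3 ∧ pairProd tameSymbol (fun i => ratUnit p (a' i)) ≠ 1
    obtain ⟨c, hc⟩ := exists_valuation_eq P fun q hq =>
      Nat.prime_of_mem_primeFactors (Finset.mem_filter.1 hq).1
    refine ⟨c, c.ne_zero, (isNonzeroSquare_abs_prod_mul_iff heven c.ne_zero).2 hsq, ?_⟩
    intro p hp hodd
    rw [key hsq c p hodd, hc, unitChar_neg_one hodd]
    by_cases hp4 : p % 4 = 1
    · rw [if_pos hp4, one_zpow, one_mul]
      exact (localInvariant_eq_one_iff_pairProd hodd a').1 (h p hp4)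
    · rw [if_neg hp4]
      have hp3 : p % 4 = 3 := by
        have := Nat.odd_iff.1 hodd
        omega
      by_cases h1 : pairProd tameSymbol (fun i => ratUnit p (a' i)) = 1
      · rw [if_neg, zpow_zero, h1, one_mul]
        intro hmem
        obtain ⟨_, _, h2⟩ := (Finset.mem_filter.1 hmem).2
        exact h2 h1
      · rw [if_pos, zpow_one, (Int.units_eq_one_or _).resolve_left h1]
        · decide
        · refine Finset.mem_filter.2 ⟨?_, hp, hp3, h1⟩
          rw [Nat.mem_primeFactors]
          refine ⟨hp.out, ?_, Int.natAbs_ne_zero.2 hN⟩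
          rw [← Int.natCast_dvd]
          by_contra hdvd
          exact h1 (pairProd_ratUnit_eq_one fun i hi =>
            hdvd (hi.trans (Finset.dvd_prod_of_mem _ (Finset.mem_univ i))))

end Criteria

end RatPDA

open RatPDA in
theorem theorem3p3 {A : Type*} [Ring A] [Algebra ℚ A] (𝒜 : ℕ → Submodule ℚ A) [GradedAlgebra 𝒜]
    (k : ℕ) (h : IsPDA 𝒜 (4 * k)) (r : ℕ) (hr : r = Module.finrank ℚ (𝒜 (2 * k))) :
    (Odd r →
      (∀ (ω : 𝒜 (4 * k)) (hω : ω ≠ 0), ∃ (c : ℚ) (hc : c ≠ 0),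
        HasDiscriminant (poincareForm h (c • ω) (smul_ne_zero hc hω)) 1) ∧
      (∀ (ω : 𝒜 (4 * k)) (hω : ω ≠ 0) (e : Module.Basis (Fin r) ℚ (𝒜 (2 * k))) (a : Fin r → ℚ),
        LinearMap.BilinForm.toMatrix e (poincareForm h ω hω) = Matrix.diagonal a →
        IsNonzeroSquare (∏ i, a i) →
        (IsIntegral h ↔ ∀ (p : ℕ) [Fact p.Prime], Odd p → localInvariant p a = 1))) ∧
    (Even r →
      ∀ (ω : 𝒜 (4 * k)) (hω : ω ≠ 0) (e : Module.Basis (Fin r) ℚ (𝒜 (2 * k))) (a : Fin r → ℚ),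
        LinearMap.BilinForm.toMatrix e (poincareForm h ω hω) = Matrix.diagonal a →
        ((r % 4 = 0 ∧ SignType.sign (∏ i, a i) = 1 ∨ r % 4 = 2 ∧ SignType.sign (∏ i, a i) = -1) →
          (IsIntegral h ↔ IsNonzeroSquare |∏ i, a i| ∧
            ∀ (p : ℕ) [Fact p.Prime], Odd p → localInvariant p a = 1)) ∧
        ((r % 4 = 0 ∧ SignType.sign (∏ i, a i) = -1 ∨ r % 4 = 2 ∧ SignType.sign (∏ i, a i) = 1) →
          (IsIntegral h ↔ IsNonzeroSquare |∏ i, a i| ∧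
            ∀ (p : ℕ) [Fact p.Prime], p % 4 = 1 → localInvariant p a = 1))) := by
  refine ⟨fun hodd => ⟨fun ω hω => exists_hasDiscriminant_one h hω (hr ▸ hodd),
    fun ω hω e a ha hsq => ?_⟩, fun heven ω hω e a ha => ⟨fun hc => ?_, fun hc => ?_⟩⟩
  · rw [isIntegral_iff h hω ha]
    exact exists_scaling_iff_of_odd hodd (diagonal_ne_zero h hω ha) hsq
  · rw [isIntegral_iff h hω ha]
    exact exists_scaling_iff_of_split (diagonal_ne_zero h hω ha) hc
  · rw [isIntegral_iff h hω ha]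
    exact exists_scaling_iff_of_nonsplit (diagonal_ne_zero h hω ha) hc
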